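/- Let $k$ be a field and let $A=\bigoplus_{i\ge 0}A_i$ be a standard graded $k$-algebra, possibly noncommutative: $A_0=k$, every $A_i$ is finite dimensional over $k$, and $A$ is generated by $A_1$ as a $k$-algebra. Put $\mathfrak m=A_{>0}$; modules are left modules. Assume that $A$ is Koszul, that is, $k=A/\mathfrak m$ has a graded free resolution $P_\bullet$ over $A$ in which $P_i$ is generated in degree $i$ for every $i$. Let $V=A_1$, let $Q_2=\ker(V\otimes_k V\to A_2)$ be the kernel of multiplication, and let $A^!=T(V^*)/(Q_2^\perp)$ be the quadratic dual algebra, where $Q_2^\perp\subseteq V^*\otimes_k V^*$ is the orthogonal complement of $Q_2$ for the pairing $\langle v_1\otimes v_2,\xi_1\otimes\xi_2\rangle=\xi_1(v_1)\xi_2(v_2)$. Let $(A^!)_n$ be the image of $(V^*)^{\otimes n}$ and $(A^!)^*_n=\operatorname{Hom}_k((A^!)_n,k)$. For $\xi\in V^*$ and $f\in(A^!)^*_{n+1}$ define $f\xi,\ \xi f\in(A^!)^*_n$ by $(f\xi)(y)=f(\xi y)$ and $(\xi f)(y)=f(y\xi)$. Let $x_1,\dots,x_d$ be a basis of $A_1$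 with dual basis $x_1^*,\dots,x_d^*$. On the free $A$-modules $F_{n,a}=A\otimes_k(A^!)^*_n\otimes_k A_a$ ($n,a\ge0$; $A$ acts on the first factor, and $A_j\otimes_k(A^!)^*_n\otimes_k A_a$ has degree $j+n+a$) define $$\partial'\colon F_{n+1,a}\to F_{n,a},\quad r\otimes f\otimes s\mapsto\sum_i rx_i\otimes fx_i^*\otimes s,$$ $$\partial''\colon F_{n+1,a}\to F_{n,a+1},\quad r\otimes f\otimes s\mapsto\sum_i r\otimes x_i^*f\otimes x_is .$$ For $a\ge1$ and $n\ge0$ let $L^A_{n,a}=\operatorname{im}\bigl(\partial''\colon F_{n+1,a-1}\to F_{n,a}\bigr)$, graded as a submodule of $F_{n,a}$. Since $\partial'$ and $\partial''$ commute, $\partial'$ induces maps $\partial'_n\colon L^A_{n,a}\to L^A_{n-1,a}$ for $n\ge1$. Let $\varepsilon_a\colon L^A_{0,a}\to\mathfrak m^a$ be the restriction of the multiplication map $F_{0,a}=A\otimes_k k\otimes_k A_a\to A$, $r\otimes v\otimes s\mapsto rvs$. Then for every $a\ge1$: 1. $L^A_{0,a}=F_{0,a}$, and $L^A_{n,a}=\ker\bigl(\partial''\colon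 F_{n,a}\to F_{n-1,a+1}\bigr)$ for all $n\ge1$. 2. The complex $$\cdots\to L^A_{n,a}\xrightarrow{\partial'_n}L^A_{n-1,a}\to\cdots\xrightarrow{\partial'_1}L^A_{0,a}\xrightarrow{\varepsilon_a}\mathfrak m^a\to0$$ is a minimal graded free resolution of $\mathfrak m^a$ over $A$. That is: each $L^A_{n,a}$ is a graded $A$-module with an $A$-basis of homogeneous elements, all maps are homogeneous of degree $0$, the sequence is exact, and $\partial'_n(L^A_{n,a})\subseteq\mathfrak m\,L^A_{n-1,a}$ for all $n\ge1$. -/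

import Mathlib

open scoped TensorProduct

set_option linter.unusedSectionVars false

namespace KoszulPowers

/-! ### Graded modules and graded free resolutions over a graded ring -/

section Graded

universe u v w

variable {k : Type v} {A : Type u} [Field k] [Ring A] [Algebra k A]

/-- The standing assumptions on the graded `k`-algebra `A = ⨁ 𝒜 i` (indexed by `ℕ`, so that
`A_i = 0` for `i < 0`): `A_0 = k`, the graded components are finite dimensional, and `A` is
generated by `A_1` as a `k`-algebra. No commutativity is assumed. -/
structure IsStandardGraded (𝒜 : ℕ → Submodule k A) [GradedAlgebra 𝒜] : Prop where
  nontrivial : Nontrivial A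
  connected : 𝒜 0 = 1
  finite (i : ℕ) : Module.Finite k (𝒜 i)
  generated : Algebra.adjoin k (𝒜 1 : Set A) = ⊤

/-- The homogeneous maximal ideal `𝔪 = A_{>0}`, as a left ideal (it is two-sided). -/
def maxIdeal (𝒜 : ℕ → Submodule k A) [GradedAlgebra 𝒜] : Ideal A :=
  (HomogeneousIdeal.irrelevant 𝒜).toIdeal

/-- `gr` makes the left `A`-module `X` a graded `A`-module: `X = ⨁ X_j` and
`A_i X_j ⊆ X_{i+j}`. -/
structure IsGradedModule (𝒜 : ℕ → Submodule k A) {X : Type w} [AddCommGroup X] [Module A X]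
    (gr : ℕ → AddSubgroup X) : Prop where
  isInternal : DirectSum.IsInternal gr
  smul_mem {i j : ℕ} {r : A} {y : X} : r ∈ 𝒜 i → y ∈ gr j → r • y ∈ gr (i + j)

/-- A graded free module: a graded module with a basis of homogeneous elements. -/
structure IsGradedFree (𝒜 : ℕ → Submodule k A) {X : Type w} [AddCommGroup X] [Module A X]
    (gr : ℕ → AddSubgroup X) : Prop extends IsGradedModule 𝒜 gr where
  exists_basis : ∃ (ι : Type w) (b : Module.Basis ι A X), ∀ i, ∃ j, b i ∈ gr j

/-- `⋯ → X 2 → X 1 → X 0 → M → 0` is a graded free resolution of the graded left `A`-module `M`: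
the `X n` are graded free, all maps are homogeneous of degree `0`, and the augmented sequence is
exact (in particular it is a complex). -/
structure IsGradedFreeResolution (𝒜 : ℕ → Submodule k A)
    {X : ℕ → Type w} [∀ n, AddCommGroup (X n)] [∀ n, Module A (X n)]
    (gr : ∀ n, ℕ → AddSubgroup (X n)) (d : ∀ n, X (n + 1) →ₗ[A] X n)
    {M : Type u} [AddCommGroup M] [Module A M] (grM : ℕ → AddSubgroup M)
    (ε : X 0 →ₗ[A] M) : Prop where
  gradedFree (n : ℕ) : IsGradedFree 𝒜 (gr n)
  gradedModule : IsGradedModule 𝒜 grM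
  map_mem (n j : ℕ) (y : X (n + 1)) : y ∈ gr (n + 1) j → d n y ∈ gr n j
  augmentation_mem (j : ℕ) (y : X 0) : y ∈ gr 0 j → ε y ∈ grM j
  exact (n : ℕ) : Function.Exact (d (n + 1)) (d n)
  exact_augmentation : Function.Exact (d 0) ε
  surjective : Function.Surjective ε

/-- A graded free resolution which is minimal: `d (X (n+1)) ⊆ 𝔪 (X n)` for all `n`. -/
structure IsMinimalGradedFreeResolution (𝒜 : ℕ → Submodule k A) [GradedAlgebra 𝒜]
    {X : ℕ → Type w} [∀ n, AddCommGroup (X n)] [∀ n, Module A (X n)]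
    (gr : ∀ n, ℕ → AddSubgroup (X n)) (d : ∀ n, X (n + 1) →ₗ[A] X n)
    {M : Type u} [AddCommGroup M] [Module A M] (grM : ℕ → AddSubgroup M)
    (ε : X 0 →ₗ[A] M) : Prop extends IsGradedFreeResolution 𝒜 gr d grM ε where
  minimal (n : ℕ) : LinearMap.range (d n) ≤ maxIdeal 𝒜 • (⊤ : Submodule A (X n))

/-- The grading of the residue field `k = A ⧸ 𝔪` induced by the one of `A` (it is concentrated in
degree `0`). -/
def residueGrading (𝒜 : ℕ → Submodule k A) [GradedAlgebra 𝒜] (j : ℕ) :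
    AddSubgroup (A ⧸ maxIdeal 𝒜) :=
  (𝒜 j).toAddSubgroup.map (Submodule.mkQ (maxIdeal 𝒜)).toAddMonoidHom

/-- The grading of a left ideal `I` by `I_j = I ∩ A_j`. -/
def idealGrading (𝒜 : ℕ → Submodule k A) (I : Ideal A) (j : ℕ) : AddSubgroup I :=
  (𝒜 j).toAddSubgroup.comap (Submodule.subtype I).toAddMonoidHom

/-- `A` is Koszul: the left `A`-module `k = A ⧸ A_{>0}` has a graded free resolution `P` that is
linear, that is, the module `P i` is generated by its elements of degree `i`. -/
def IsKoszul (𝒜 : ℕ → Submodule k A) [GradedAlgebra 𝒜] : Prop :=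
  ∃ (P : ℕ → Type u) (_ : ∀ n, AddCommGroup (P n)) (_ : ∀ n, Module A (P n))
    (gr : ∀ n, ℕ → AddSubgroup (P n)) (d : ∀ n, P (n + 1) →ₗ[A] P n)
    (ε : P 0 →ₗ[A] (A ⧸ maxIdeal 𝒜)),
    IsGradedFreeResolution 𝒜 gr d (residueGrading 𝒜) ε ∧
      ∀ i, Submodule.span A (gr i i : Set (P i)) = ⊤

end Graded

noncomputable section

universe u v

variable {k : Type v} {A : Type u} [Field k] [Ring A] [Algebra k A]

/-! ### The quadratic dual algebra -/

/-- The space `Q_2 ⊆ V ⊗ V` of quadratic relations of `A`, where `V = A_1`: the kernel of the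
multiplication `A_1 ⊗ A_1 → A`. -/
def quadRel (𝒜 : ℕ → Submodule k A) : Submodule k (𝒜 1 ⊗[k] 𝒜 1) :=
  LinearMap.ker (LinearMap.mul' k A ∘ₗ TensorProduct.map (𝒜 1).subtype (𝒜 1).subtype)

/-- The orthogonal complement of `Q_2` in `V^* ⊗ V^*` for the pairing
`⟨v₁ ⊗ v₂, ξ₁ ⊗ ξ₂⟩ = ξ₁ v₁ * ξ₂ v₂`. -/
def quadRelPerp (𝒜 : ℕ → Submodule k A) :
    Submodule k (Module.Dual k (𝒜 1) ⊗[k] Module.Dual k (𝒜 1)) :=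
  (quadRel 𝒜).dualAnnihilator.comap (TensorProduct.dualDistrib k (𝒜 1) (𝒜 1))

/-- The identification of `V^* ⊗ V^*` with the degree `2` part of the tensor algebra `T(V^*)`. -/
def tensorTwo (𝒜 : ℕ → Submodule k A) :
    Module.Dual k (𝒜 1) ⊗[k] Module.Dual k (𝒜 1) →ₗ[k] TensorAlgebra k (Module.Dual k (𝒜 1)) :=
  LinearMap.mul' k _ ∘ₗ TensorProduct.map (TensorAlgebra.ι k) (TensorAlgebra.ι k)

/-- The relations `t = 0` of `A^!`, for `t` in the orthogonal complement of `Q_2`. -/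
inductive QuadraticDualRel (𝒜 : ℕ → Submodule k A) :
    TensorAlgebra k (Module.Dual k (𝒜 1)) → TensorAlgebra k (Module.Dual k (𝒜 1)) → Prop
  | perp (t : Module.Dual k (𝒜 1) ⊗[k] Module.Dual k (𝒜 1)) (ht : t ∈ quadRelPerp 𝒜) :
      QuadraticDualRel 𝒜 (tensorTwo 𝒜 t) 0

/-- The quadratic dual algebra `A^! = T(V^*) / (Q_2^⊥)` with `V = A_1`. -/
abbrev QuadraticDual (𝒜 : ℕ → Submodule k A) :=
  RingQuot (QuadraticDualRel 𝒜)

/-- The inclusion of the generators `V^* → A^!`. -/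
def dualGen (𝒜 : ℕ → Submodule k A) : Module.Dual k (𝒜 1) →ₗ[k] QuadraticDual 𝒜 :=
  (RingQuot.mkAlgHom k (QuadraticDualRel 𝒜)).toLinearMap ∘ₗ TensorAlgebra.ι k

/-- The graded component `(A^!)_n`: the span of all products of `n` generators. -/
def dualComp (𝒜 : ℕ → Submodule k A) (n : ℕ) : Submodule k (QuadraticDual 𝒜) :=
  LinearMap.range (dualGen 𝒜) ^ n

/-- The graded dual `(A^!)^*_n = Hom_k((A^!)_n, k)`. -/
abbrev DualCoalg (𝒜 : ℕ → Submodule k A) (n : ℕ) := Module.Dual k (dualComp 𝒜 n)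

/-- Left multiplication `y ↦ ξ y` by a generator `ξ ∈ V^*`, as a map `(A^!)_n → (A^!)_{n+1}`. -/
def genMulLeft (𝒜 : ℕ → Submodule k A) (ξ : Module.Dual k (𝒜 1)) (n : ℕ) :
    dualComp 𝒜 n →ₗ[k] dualComp 𝒜 (n + 1) :=
  (LinearMap.mulLeft k (dualGen 𝒜 ξ)).restrict fun y hy => by
    rw [dualComp, pow_succ']
    exact Submodule.mul_mem_mul (LinearMap.mem_range_self _ ξ) hy

/-- Right multiplication `y ↦ y ξ` by a generator `ξ ∈ V^*`, as a map `(A^!)_n → (A^!)_{n+1}`. -/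
def genMulRight (𝒜 : ℕ → Submodule k A) (ξ : Module.Dual k (𝒜 1)) (n : ℕ) :
    dualComp 𝒜 n →ₗ[k] dualComp 𝒜 (n + 1) :=
  (LinearMap.mulRight k (dualGen 𝒜 ξ)).restrict fun y hy => by
    rw [dualComp, pow_succ]
    exact Submodule.mul_mem_mul hy (LinearMap.mem_range_self _ ξ)

/-- The right action of `ξ ∈ V^*` on `(A^!)^*`, dual to left multiplication on `A^!`:
`(f · ξ)(y) = f (ξ y)`. -/
def actRight (𝒜 : ℕ → Submodule k A) (ξ : Module.Dual k (𝒜 1)) (n : ℕ) :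
    DualCoalg 𝒜 (n + 1) →ₗ[k] DualCoalg 𝒜 n :=
  (genMulLeft 𝒜 ξ n).dualMap

/-- The left action of `ξ ∈ V^*` on `(A^!)^*`, dual to right multiplication on `A^!`:
`(ξ · f)(y) = f (y ξ)`. -/
def actLeft (𝒜 : ℕ → Submodule k A) (ξ : Module.Dual k (𝒜 1)) (n : ℕ) :
    DualCoalg 𝒜 (n + 1) →ₗ[k] DualCoalg 𝒜 n :=
  (genMulRight 𝒜 ξ n).dualMap

theorem actRight_actLeft (𝒜 : ℕ → Submodule k A) (ξ η : Module.Dual k (𝒜 1)) (n : ℕ) (f : DualCoalg 𝒜 (n + 1 + 1)) :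
    actRight 𝒜 ξ n (actLeft 𝒜 η (n + 1) f) = actLeft 𝒜 η n (actRight 𝒜 ξ (n + 1) f) := by
  ext y
  simp only [actRight, actLeft, LinearMap.dualMap_apply]
  congr 1
  ext
  simp [genMulLeft, genMulRight, mul_assoc]

/-! ### The double complex `A ⊗ (A^!)^*_n ⊗ A_a` -/

section Complex

variable (𝒜 : ℕ → Submodule k A) [GradedAlgebra 𝒜]

/-- Left multiplication by `v ∈ A_1`, as a map `A_a → A_{a+1}`. -/
def mulDegOne (v : 𝒜 1) (a : ℕ) : 𝒜 a →ₗ[k] 𝒜 (a + 1) :=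
  (LinearMap.mulLeft k (v : A)).restrict fun y hy => by
    have h := SetLike.mul_mem_graded v.2 hy
    rwa [add_comm] at h

/-- The free left `A`-module `F_{n,a} = A ⊗_k (A^!)^*_n ⊗_k A_a`, with `A` acting on the first
factor. -/
abbrev F (n a : ℕ) := A ⊗[k] (DualCoalg 𝒜 n ⊗[k] 𝒜 a)

/-- The internal grading of `F_{n,a}`: `A_j ⊗ (A^!)^*_n ⊗ A_a` has degree `j + n + a`. -/
def fGrading (n a e : ℕ) : AddSubgroup (F 𝒜 n a) :=
  AddSubgroup.closure
    {z | ∃ (j : ℕ) (r : A) (w : DualCoalg 𝒜 n ⊗[k] 𝒜 a), j + n + a = e ∧ r ∈ 𝒜 j ∧ z = r ⊗ₜ[k] w}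

variable {ι : Type*} [Fintype ι] (x : Module.Basis ι k (𝒜 1))

/-- The vertical differential `∂'`, right multiplication by `∑ x_i ⊗ x_i^* ⊗ 1`:
`r ⊗ f ⊗ s ↦ ∑ r x_i ⊗ (f · x_i^*) ⊗ s`. -/
def vDiff (n a : ℕ) : F 𝒜 (n + 1) a →ₗ[A] F 𝒜 n a :=
  ∑ i, TensorProduct.AlgebraTensorModule.map
    (LinearMap.toSpanSingleton A A (x i : A)) ((actRight 𝒜 (x.coord i) n).rTensor (𝒜 a))

/-- The horizontal differential `∂''`, left multiplication by `∑ 1 ⊗ x_i^* ⊗ x_i`: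
`r ⊗ f ⊗ s ↦ ∑ r ⊗ (x_i^* · f) ⊗ x_i s`. -/
def hDiff (n a : ℕ) : F 𝒜 (n + 1) a →ₗ[A] F 𝒜 n (a + 1) :=
  ∑ i, TensorProduct.AlgebraTensorModule.map
    (LinearMap.id : A →ₗ[A] A)
    (TensorProduct.map (actLeft 𝒜 (x.coord i) n) (mulDegOne 𝒜 (x i) a))

@[simp]
theorem vDiff_tmul (n a : ℕ) (r : A) (f : DualCoalg 𝒜 (n + 1)) (s : 𝒜 a) :
    vDiff 𝒜 x n a (r ⊗ₜ (f ⊗ₜ s)) =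
      ∑ i, (r * (x i : A)) ⊗ₜ[k] (actRight 𝒜 (x.coord i) n f ⊗ₜ[k] s) := by
  simp [vDiff, LinearMap.sum_apply]

@[simp]
theorem hDiff_tmul (n a : ℕ) (r : A) (f : DualCoalg 𝒜 (n + 1)) (s : 𝒜 a) :
    hDiff 𝒜 x n a (r ⊗ₜ (f ⊗ₜ s)) =
      ∑ i, r ⊗ₜ[k] (actLeft 𝒜 (x.coord i) n f ⊗ₜ[k] mulDegOne 𝒜 (x i) a s) := by
  simp [hDiff, LinearMap.sum_apply]

/-- The differentials `∂'` and `∂''` commute. -/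
theorem vDiff_hDiff (n a : ℕ) (z : F 𝒜 (n + 1 + 1) a) :
    vDiff 𝒜 x n (a + 1) (hDiff 𝒜 x (n + 1) a z) = hDiff 𝒜 x n a (vDiff 𝒜 x (n + 1) a z) := by
  induction z using TensorProduct.induction_on with
  | zero => simp only [map_zero]
  | add y z hy hz => simp only [map_add, hy, hz]
  | tmul r w =>
    induction w using TensorProduct.induction_on with
    | zero => simp only [TensorProduct.tmul_zero, map_zero]
    | add y z hy hz => simp only [TensorProduct.tmul_add, map_add, hy, hz]
    | tmul f s =>
      simp only [vDiff_tmul, hDiff_tmul, map_sum, actRight_actLeft]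
      exact Finset.sum_comm

/-! ### The complexes `L_a` -/

/-- The module `L_{n,a} = im (∂'' : F_{n+1,a-1} → F_{n,a})` for `a ≥ 1` (the sign `(-1)^{n+1}` in
front of `∂''` does not change the image). For `a = 0` it is `0`, since `A_{-1} = 0`. -/
def L (n : ℕ) : (a : ℕ) → Submodule A (F 𝒜 n a)
  | 0 => ⊥
  | a + 1 => LinearMap.range (hDiff 𝒜 x n a)

theorem vDiff_mem_L (n a : ℕ) (z : F 𝒜 (n + 1) a) (hz : z ∈ L 𝒜 x (n + 1) a) :
    vDiff 𝒜 x n a z ∈ L 𝒜 x n a := by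
  cases a with
  | zero =>
    obtain rfl : z = 0 := hz
    rw [map_zero]
    exact Submodule.zero_mem _
  | succ a =>
    obtain ⟨y, rfl⟩ := hz
    exact ⟨vDiff 𝒜 x (n + 1) a y, (vDiff_hDiff 𝒜 x n a y).symm⟩

/-- The differential `L_{n+1,a} → L_{n,a}` of the complex `L_a`, induced by `∂'`. -/
def lDiff (a n : ℕ) : L 𝒜 x (n + 1) a →ₗ[A] L 𝒜 x n a :=
  (vDiff 𝒜 x n a).restrict (vDiff_mem_L 𝒜 x n a)

/-- The internal grading of `L_{n,a}`, induced by the one of `F_{n,a}`. -/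
def lGrading (a n e : ℕ) : AddSubgroup (L 𝒜 x n a) :=
  (fGrading 𝒜 n a e).comap (L 𝒜 x n a).subtype.toAddMonoidHom

/-- The multiplication map `F_{0,a} = A ⊗ (A^!)^*_0 ⊗ A_a → A`, `r ⊗ v ⊗ s ↦ r v s`, where
`v ∈ (A^!)^*_0 = Hom_k(k, k)` is identified with the scalar `v(1)`. -/
def mulMap (a : ℕ) : F 𝒜 0 a →ₗ[A] A :=
  TensorProduct.AlgebraTensorModule.lift
    (LinearMap.toSpanSingleton A ((DualCoalg 𝒜 0 ⊗[k] 𝒜 a) →ₗ[k] A)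
      ((𝒜 a).subtype ∘ₗ TensorProduct.lift
        (LinearMap.lsmul k (𝒜 a) ∘ₗ
          Module.Dual.eval k (dualComp 𝒜 0) ⟨1, Submodule.one_le.mp (pow_zero _).ge⟩)))

theorem mulMap_tmul (a : ℕ) (r : A) (f : DualCoalg 𝒜 0) (s : 𝒜 a) :
    mulMap 𝒜 a (r ⊗ₜ (f ⊗ₜ s)) =
      r * (f ⟨1, Submodule.one_le.mp (pow_zero _).ge⟩ • (s : A)) := by
  simp [mulMap]

variable {𝒜}

theorem IsStandardGraded.le_pow (h : IsStandardGraded 𝒜) (a : ℕ) (s : A) (hs : s ∈ 𝒜 a) :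
    s ∈ maxIdeal 𝒜 ^ a := by
  have : (maxIdeal 𝒜).IsTwoSided :=
    inferInstanceAs (RingHom.ker (GradedRing.projZeroRingHom 𝒜)).IsTwoSided
  have key : ∀ y ∈ Algebra.adjoin k (𝒜 1 : Set A), ∀ n,
      (DirectSum.decompose 𝒜 y n : A) ∈ maxIdeal 𝒜 ^ n := by
    intro y hy
    induction hy using Algebra.adjoin_induction with
    | mem y hy =>
      intro n
      by_cases hn : 1 = n
      · subst hn
        rw [DirectSum.decompose_of_mem_same 𝒜 hy, Submodule.pow_one]
        exact HomogeneousIdeal.mem_irrelevant_of_mem 𝒜 one_pos hy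
      · rw [DirectSum.decompose_of_mem_ne 𝒜 hy hn]
        exact Submodule.zero_mem _
    | algebraMap c =>
      intro n
      have hc : algebraMap k A c ∈ 𝒜 0 := SetLike.algebraMap_mem_graded 𝒜 c
      by_cases hn : 0 = n
      · subst hn
        rw [Submodule.pow_zero, Ideal.one_eq_top]
        trivial
      · rw [DirectSum.decompose_of_mem_ne 𝒜 hc hn]
        exact Submodule.zero_mem _
    | add y z _ _ hy hz =>
      intro n
      rw [DirectSum.decompose_add]
      exact Submodule.add_mem _ (hy n) (hz n)
    | mul y z _ _ hy hz =>
      classical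
      intro n
      rw [DirectSum.decompose_mul, DirectSum.coe_mul_apply]
      refine Submodule.sum_mem _ fun ij hij => ?_
      rw [← (Finset.mem_filter.mp hij).2, Ideal.IsTwoSided.pow_add]
      exact Ideal.mul_mem_mul (hy _) (hz _)
  have := key s (by rw [h.generated]; trivial) a
  rwa [DirectSum.decompose_of_mem_same 𝒜 hs] at this

theorem mulMap_mem (h : IsStandardGraded 𝒜) (a : ℕ) (z : F 𝒜 0 a) :
    mulMap 𝒜 a z ∈ maxIdeal 𝒜 ^ a := by
  induction z using TensorProduct.induction_on with
  | zero => rw [map_zero]; exact Submodule.zero_mem _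
  | add y z hy hz => rw [map_add]; exact Submodule.add_mem _ hy hz
  | tmul r w =>
    induction w using TensorProduct.induction_on with
    | zero => rw [TensorProduct.tmul_zero, map_zero]; exact Submodule.zero_mem _
    | add y z hy hz => rw [TensorProduct.tmul_add, map_add]; exact Submodule.add_mem _ hy hz
    | tmul f s =>
      rw [mulMap_tmul]
      exact Ideal.mul_mem_left _ _ (h.le_pow a _ ((𝒜 a).smul_mem _ s.2))

/-- The augmentation `ε_a : L_{0,a} → 𝔪^a`, the restriction of the multiplication map. -/
def augmentation (h : IsStandardGraded 𝒜) (a : ℕ) :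
    L 𝒜 x 0 a →ₗ[A] (maxIdeal 𝒜 ^ a : Ideal A) :=
  (mulMap 𝒜 a ∘ₗ (L 𝒜 x 0 a).subtype).codRestrict _ fun z => mulMap_mem h a z

end Complex

end

end KoszulPowers

open KoszulPowers

namespace KoszulPowers

open DirectSum

noncomputable section

universe u v w

variable {k : Type v} {A : Type u} [Field k] [Ring A] [Algebra k A]
  {𝒜 : ℕ → Submodule k A} [GradedAlgebra 𝒜]

/-! ### The irrelevant ideal of a standard graded algebra -/

/-! The modules `F 𝒜 n a` form a double complex. For fixed `a` the column with differential `∂'` is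
the left Koszul complex `A ⊗ (A^!)^*` tensored over `k` with `A_a`. The rows, with differential
`∂''`, are `A` tensored over `k` with the strands of the right Koszul complex `(A^!)^* ⊗ A`.
Everything follows from exactness of columns and rows.

Columns (`koszulCycles_le_range`). A linear resolution `P` of `k` is matched with the left Koszul
complex degree by degree. Linearity makes `P_{n+1}` equal to `A ⊗ W`, where `W` is the lowest-degree
part of the `n`-th syzygy (`exists_equiv_tensor`). Under the isomorphism already built for `P_n`,
this part consists of the cycles `∑ x_i ⊗ f_i`, and each of them comes from a unique `g ∈
(A^!)^*_{n+1}` with `g x_i^* = f_i` (`exists_actRight_eq_of_contract`,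
`eq_zero_of_actRight_eq_zero`).

Rows (`rowCycles_le_L`). Koszulness of the opposite algebra is not invoked; the rows are deduced
from the columns by induction on `n`. If the rows are exact in position `n` for all `a`, a zigzag by
induction on `a` shows that every `y ∈ F_{n+1,a}` with `∂' y` a row cycle lies in `L_{n+1,a} + im
∂'` (`mem_sup_range_of_rowCycles_le`). Applied to `1 ⊗ w` and reduced modulo `𝔪`, which kills `im
∂'`, this gives exactness of the strand over `k`; flatness of `A` over `k` gives the row.

The complex `L_a`. A `∂'`-cycle `y ∈ L_{n,a}` is `∂' w` by column exactness. As `y` is a row cycle,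
the same zigzag writes `w = l + ∂' u` with `l ∈ L`, so `y = ∂' l`. Freeness holds because `L_{n,a} =
A ⊗ B` with `B` the image of the strand differential over `k`, and minimality because `∂'`
multiplies by the `x_i`. -/

theorem mem_maxIdeal_iff (r : A) : r ∈ maxIdeal 𝒜 ↔ (decompose 𝒜 r 0 : A) = 0 :=
  HomogeneousIdeal.mem_irrelevant_iff 𝒜 r

instance maxIdeal_isTwoSided : (maxIdeal 𝒜).IsTwoSided :=
  inferInstanceAs (RingHom.ker (GradedRing.projZeroRingHom 𝒜)).IsTwoSided

theorem mem_maxIdeal_of_mem {r : A} {i : ℕ} (hi : i ≠ 0) (hr : r ∈ 𝒜 i) : r ∈ maxIdeal 𝒜 :=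
  HomogeneousIdeal.mem_irrelevant_of_mem 𝒜 (Nat.pos_of_ne_zero hi) hr

theorem IsStandardGraded.algebraMap_injective (h : IsStandardGraded 𝒜) :
    Function.Injective (algebraMap k A) :=
  haveI := h.nontrivial
  FaithfulSMul.algebraMap_injective k A

/-- The projection of `A` onto `A_0 = k`. -/
def coeffZero (h : IsStandardGraded 𝒜) : A →ₗ[k] k :=
  (LinearEquiv.ofInjective (Algebra.linearMap k A) h.algebraMap_injective).symm.toLinearMap ∘ₗ
    (GradedAlgebra.proj 𝒜 0).codRestrict _ fun r => by
      rw [← Submodule.one_eq_range, ← h.connected]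
      exact SetLike.coe_mem _

theorem algebraMap_coeffZero (h : IsStandardGraded 𝒜) (r : A) :
    algebraMap k A (coeffZero h r) = (decompose 𝒜 r 0 : A) := by
  have := LinearEquiv.apply_symm_apply
    (LinearEquiv.ofInjective (Algebra.linearMap k A) h.algebraMap_injective)
    ((GradedAlgebra.proj 𝒜 0).codRestrict _ (fun r => by
      rw [← Submodule.one_eq_range, ← h.connected]
      exact SetLike.coe_mem _) r)
  exact congrArg Subtype.val this

theorem coeffZero_eq_zero_iff (h : IsStandardGraded 𝒜) (r : A) :
    coeffZero h r = 0 ↔ r ∈ maxIdeal 𝒜 := by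
  rw [mem_maxIdeal_iff, ← algebraMap_coeffZero h, map_eq_zero_iff _ h.algebraMap_injective]

theorem algebraMap_coeffZero_of_mem (h : IsStandardGraded 𝒜) {r : A} (hr : r ∈ 𝒜 0) :
    algebraMap k A (coeffZero h r) = r := by
  rw [algebraMap_coeffZero, decompose_of_mem_same 𝒜 hr]

@[simp]
theorem coeffZero_algebraMap (h : IsStandardGraded 𝒜) (c : k) :
    coeffZero h (algebraMap k A c) = c :=
  h.algebraMap_injective (algebraMap_coeffZero_of_mem h (SetLike.algebraMap_mem_graded 𝒜 c))

@[simp]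
theorem coeffZero_one (h : IsStandardGraded 𝒜) : coeffZero h 1 = 1 := by
  rw [← map_one (algebraMap k A), coeffZero_algebraMap]

theorem coeffZero_mul_of_mem (h : IsStandardGraded 𝒜) (r : A) {s : A} (hs : s ∈ 𝒜 1) :
    coeffZero h (r * s) = 0 :=
  (coeffZero_eq_zero_iff h _).2
    (Ideal.mul_mem_left _ _ (mem_maxIdeal_of_mem one_ne_zero hs))

theorem maxIdeal_eq_span (h : IsStandardGraded 𝒜) :
    maxIdeal 𝒜 = Ideal.span (𝒜 1 : Set A) := by
  have hle : Ideal.span (𝒜 1 : Set A) ≤ maxIdeal 𝒜 :=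
    Ideal.span_le.2 fun r hr => mem_maxIdeal_of_mem one_ne_zero hr
  refine le_antisymm (fun y hy => ?_) hle
  have key : ∀ y ∈ Algebra.adjoin k (𝒜 1 : Set A), ∃ c : k,
      y - algebraMap k A c ∈ Ideal.span (𝒜 1 : Set A) := by
    intro y hy
    induction hy using Algebra.adjoin_induction with
    | mem y hy => exact ⟨0, by simpa using Ideal.subset_span hy⟩
    | algebraMap c => exact ⟨c, by simp⟩
    | add y z _ _ hy hz =>
      obtain ⟨c, hc⟩ := hy
      obtain ⟨d, hd⟩ := hz
      refine ⟨c + d, ?_⟩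
      rw [map_add, add_sub_add_comm]
      exact add_mem hc hd
    | mul y z _ _ hy hz =>
      obtain ⟨c, hc⟩ := hy
      obtain ⟨d, hd⟩ := hz
      refine ⟨c * d, ?_⟩
      have : y * z - algebraMap k A (c * d) =
          y * (z - algebraMap k A d) + algebraMap k A d * (y - algebraMap k A c) := by
        rw [mul_sub, mul_sub, ← Algebra.commutes d y, mul_comm c d, map_mul]
        abel
      rw [this]
      exact add_mem (Ideal.mul_mem_left _ _ hd) (Ideal.mul_mem_left _ _ hc)
  obtain ⟨c, hc⟩ := key y (by rw [h.generated]; trivial)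
  have h0 := (coeffZero_eq_zero_iff h _).2 (hle hc)
  rw [map_sub, coeffZero_algebraMap, (coeffZero_eq_zero_iff h y).2 hy, zero_sub, neg_eq_zero] at h0
  simpa [h0] using hc

/-- Generation in degree one gives `A = k + A_1 A`, and the degree `a + 1` part of this is `A_1
A_a`. The generator must stand on the left here, as in `∂''`, whereas `maxIdeal_eq_span` has it on
the right. -/
theorem mem_mul_of_mem_succ (h : IsStandardGraded 𝒜) (a : ℕ) {s : A} (hs : s ∈ 𝒜 (a + 1)) :
    s ∈ 𝒜 1 * 𝒜 a := by
  have key : ∀ y ∈ Algebra.adjoin k (𝒜 1 : Set A), ∃ c : k,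
      y - algebraMap k A c ∈ 𝒜 1 * (⊤ : Submodule k A) := by
    intro y hy
    induction hy using Algebra.adjoin_induction with
    | mem y hy => exact ⟨0, by simpa using Submodule.mul_mem_mul hy (Submodule.mem_top (x := 1))⟩
    | algebraMap c => exact ⟨c, by simp⟩
    | add y z _ _ hy hz =>
      obtain ⟨c, hc⟩ := hy
      obtain ⟨d, hd⟩ := hz
      refine ⟨c + d, ?_⟩
      rw [map_add, add_sub_add_comm]
      exact add_mem hc hd
    | mul y z _ _ hy hz =>
      obtain ⟨c, hc⟩ := hy
      obtain ⟨d, hd⟩ := hz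
      refine ⟨c * d, ?_⟩
      have : y * z - algebraMap k A (c * d) =
          (y - algebraMap k A c) * z + c • (z - algebraMap k A d) := by
        rw [Algebra.smul_def, sub_mul, mul_sub, map_mul]
        abel
      rw [this]
      refine add_mem ?_ (Submodule.smul_mem _ _ hd)
      have := Submodule.mul_mem_mul hc (Submodule.mem_top (x := z) (R := k))
      rw [mul_assoc] at this
      exact mul_le_mul_right le_top (𝒜 1) this
  have hdec : ∀ y ∈ 𝒜 1 * (⊤ : Submodule k A), (decompose 𝒜 y (a + 1) : A) ∈ 𝒜 1 * 𝒜 a := by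
    intro y hy
    induction hy using Submodule.mul_induction_on' with
    | mem_mul_mem m hm n _ =>
      rw [coe_decompose_mul_of_left_mem_of_le 𝒜 hm (by omega), Nat.add_sub_cancel]
      exact Submodule.mul_mem_mul hm (SetLike.coe_mem _)
    | add y _ z _ hy hz =>
      rw [decompose_add]
      exact add_mem hy hz
  obtain ⟨c, hc⟩ := key s (by rw [h.generated]; trivial)
  have := hdec _ hc
  rwa [decompose_sub, DirectSum.sub_apply, AddSubgroupClass.coe_sub, decompose_of_mem_same 𝒜 hs,
    decompose_of_mem_ne 𝒜 (SetLike.algebraMap_mem_graded 𝒜 c) (Nat.succ_ne_zero a).symm,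
    sub_zero] at this

/-- Inductively `𝔪 · (A A_a) ⊆ 𝔪 A_a = A A_1 A_a ⊆ A A_{a+1}`, where the first inclusion uses that
`𝔪` is two-sided. -/
theorem maxIdeal_pow_eq_span (h : IsStandardGraded 𝒜) (a : ℕ) :
    maxIdeal 𝒜 ^ a = Ideal.span (𝒜 a : Set A) := by
  refine le_antisymm ?_ (Ideal.span_le.2 fun s hs => h.le_pow a s hs)
  induction a with
  | zero =>
    rw [(Ideal.eq_top_iff_one (Ideal.span (𝒜 0 : Set A))).2
      (Ideal.subset_span (SetLike.one_mem_graded 𝒜))]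
    exact le_top
  | succ a ih =>
    rw [add_comm, Ideal.IsTwoSided.pow_add, Submodule.pow_one]
    refine Ideal.mul_le.2 fun p hp q hq => ?_
    replace hq := ih hq
    clear ih
    -- `p` varies because a scalar `r` in front of `q` is absorbed into it: `p (r q) = (p r) q` with
    -- `p r ∈ 𝔪`.
    induction hq using Submodule.span_induction generalizing p with
    | mem s hs =>
      rw [maxIdeal_eq_span h] at hp
      induction hp using Submodule.span_induction with
      | mem v hv =>
        refine Ideal.subset_span ?_
        exact SetLike.mul_mem_graded (A := 𝒜) hv hs
      | zero => rw [zero_mul]; exact zero_mem _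
      | add y z _ _ hy hz => rw [add_mul]; exact add_mem hy hz
      | smul r y _ hy => rw [smul_eq_mul, mul_assoc]; exact Ideal.mul_mem_left _ _ hy
    | zero => rw [mul_zero]; exact zero_mem _
    | add y z _ _ hy hz => rw [mul_add]; exact add_mem (hy p hp) (hz p hp)
    | smul r y _ hy =>
      rw [smul_eq_mul, ← mul_assoc]
      exact hy _ (Ideal.mul_mem_right _ _ hp)

end

end KoszulPowers

namespace KoszulPowers

noncomputable section

universe u v w

/-! ### The relations of the quadratic dual algebra -/

theorem tmul_eq_zero_of_forall_functional {k : Type*} [Field k] {M N : Type*}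
    [AddCommGroup M] [Module k M] [AddCommGroup N] [Module k N] (z : M ⊗[k] N)
    (hz : ∀ θ : Module.Dual k M, TensorProduct.lid k N (θ.rTensor N z) = 0) : z = 0 := by
  classical
  let b := Module.Basis.ofVectorSpace k M
  apply (TensorProduct.equivFinsuppOfBasisLeft (N := N) b).injective
  rw [map_zero]
  ext i
  rw [Finsupp.zero_apply, ← hz (b.coord i)]
  clear hz
  induction z using TensorProduct.induction_on with
  | zero => simp
  | add y z hy hz => simp only [map_add, Finsupp.add_apply, hy, hz]
  | tmul m n => simp

theorem exists_factorization {k : Type*} [Field k] {M N : Type*}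
    [AddCommMonoid M] [Module k M] [AddCommGroup N] [Module k N] (f : M →ₗ[k] N)
    (l : Module.Dual k M) (h : ∀ m, f m = 0 → l m = 0) :
    ∃ θ : Module.Dual k N, ∀ m, θ (f m) = l m := by
  let _ : AddCommGroup M := Module.addCommMonoidToAddCommGroup k
  obtain ⟨θ, hθ⟩ := (LinearMap.range_dualMap_eq_dualAnnihilator_ker f).ge
    ((Submodule.mem_dualAnnihilator l).2 fun m hm => h m hm)
  exact ⟨θ, fun m => by rw [← hθ]; rfl⟩

section QuadraticDual

variable {k : Type v} {A : Type u} [Field k] [Ring A] [Algebra k A]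
  {𝒜 : ℕ → Submodule k A}

theorem mkAlgHom_tensorTwo_tmul (ξ η : Module.Dual k (𝒜 1)) :
    RingQuot.mkAlgHom k (QuadraticDualRel 𝒜) (tensorTwo 𝒜 (ξ ⊗ₜ η)) =
      dualGen 𝒜 ξ * dualGen 𝒜 η := by
  simp [tensorTwo, dualGen]

theorem mkAlgHom_tensorTwo_eq_zero {t : Module.Dual k (𝒜 1) ⊗[k] Module.Dual k (𝒜 1)}
    (ht : t ∈ quadRelPerp 𝒜) :
    RingQuot.mkAlgHom k (QuadraticDualRel 𝒜) (tensorTwo 𝒜 t) = 0 := by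
  rw [RingQuot.mkAlgHom_rel k (QuadraticDualRel.perp t ht), map_zero]

variable {ι : Type*} [Fintype ι] (x : Module.Basis ι k (𝒜 1))

/-- The tensor `∑ θ(x_i x_j) x_i^* ⊗ x_j^*` represents the functional `v ⊗ w ↦ θ(v w)`, which
vanishes on `Q_2`; it is therefore a relation of `A^!`. -/
theorem sum_smul_dualGen_mul (θ : Module.Dual k A) :
    ∑ i, ∑ j, θ (x i * x j : A) • (dualGen 𝒜 (x.coord i) * dualGen 𝒜 (x.coord j)) = 0 := by
  classical
  have key : TensorProduct.dualDistrib k (𝒜 1) (𝒜 1)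
      (∑ i, ∑ j, θ (x i * x j : A) • (x.coord i ⊗ₜ[k] x.coord j)) =
      θ ∘ₗ LinearMap.mul' k A ∘ₗ TensorProduct.map (𝒜 1).subtype (𝒜 1).subtype := by
    refine TensorProduct.ext (x.ext fun i => x.ext fun j => ?_)
    simp [Finsupp.single_apply]
  have hmem : (∑ i, ∑ j, θ (x i * x j : A) • (x.coord i ⊗ₜ[k] x.coord j)) ∈ quadRelPerp 𝒜 := by
    rw [quadRelPerp, Submodule.mem_comap, key, Submodule.mem_dualAnnihilator]
    intro q hq
    rw [quadRel, LinearMap.mem_ker] at hq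
    rw [LinearMap.comp_apply, hq, map_zero]
  rw [← mkAlgHom_tensorTwo_eq_zero hmem]
  simp only [map_sum, map_smul, mkAlgHom_tensorTwo_tmul]

/-- The square of `∑ x_i ⊗ x_i^*` in `A ⊗ A^!` is zero. This is the common source of `∂'² = 0` and
`∂''² = 0`. -/
theorem sum_tmul_dualGen_mul :
    ∑ i, ∑ j, (x i * x j : A) ⊗ₜ[k] (dualGen 𝒜 (x.coord i) * dualGen 𝒜 (x.coord j)) = 0 := by
  refine tmul_eq_zero_of_forall_functional _ fun θ => ?_
  simpa only [map_sum, LinearMap.rTensor_tmul, TensorProduct.lid_tmul] using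
    sum_smul_dualGen_mul x θ

/-- A functional that kills the kernel of multiplication factors through multiplication. Hence every
relation of `A^!` has the form in `sum_smul_dualGen_mul`, and conditions on all relations can be
stated through functionals `θ` on `A`. -/
theorem exists_functional_of_mem_quadRelPerp
    {t : Module.Dual k (𝒜 1) ⊗[k] Module.Dual k (𝒜 1)} (ht : t ∈ quadRelPerp 𝒜) :
    ∃ θ : Module.Dual k A, ∀ v w : 𝒜 1,
      TensorProduct.dualDistrib k (𝒜 1) (𝒜 1) t (v ⊗ₜ w) = θ (v * w) := by
  obtain ⟨θ, hθ⟩ := exists_factorization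
    (LinearMap.mul' k A ∘ₗ TensorProduct.map (𝒜 1).subtype (𝒜 1).subtype)
    (TensorProduct.dualDistrib k (𝒜 1) (𝒜 1) t)
    fun q hq => (Submodule.mem_dualAnnihilator _).1 (Submodule.mem_comap.1 ht) q hq
  exact ⟨θ, fun v w => by rw [← hθ]; simp⟩

/-- Allows a functional on one component to be evaluated on products formed in the whole algebra
`A^!`. The extensions need not depend linearly on the functional. -/
theorem exists_dual_extension (n : ℕ) : ∃ e : DualCoalg 𝒜 n → Module.Dual k (QuadraticDual 𝒜),
    ∀ f (y : dualComp 𝒜 n), e f y = f y := by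
  choose e he using fun f : DualCoalg 𝒜 n => LinearMap.exists_extend f
  exact ⟨e, fun f y => LinearMap.congr_fun (he f) y⟩

theorem genMulLeft_apply (ξ : Module.Dual k (𝒜 1)) (n : ℕ) (y : dualComp 𝒜 n) :
    (genMulLeft 𝒜 ξ n y : QuadraticDual 𝒜) = dualGen 𝒜 ξ * y := rfl

theorem genMulRight_apply (ξ : Module.Dual k (𝒜 1)) (n : ℕ) (y : dualComp 𝒜 n) :
    (genMulRight 𝒜 ξ n y : QuadraticDual 𝒜) = y * dualGen 𝒜 ξ := rfl

theorem actRight_apply (ξ : Module.Dual k (𝒜 1)) (n : ℕ) (f : DualCoalg 𝒜 (n + 1))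
    (y : dualComp 𝒜 n) : actRight 𝒜 ξ n f y = f (genMulLeft 𝒜 ξ n y) := rfl

theorem actLeft_apply (ξ : Module.Dual k (𝒜 1)) (n : ℕ) (f : DualCoalg 𝒜 (n + 1))
    (y : dualComp 𝒜 n) : actLeft 𝒜 ξ n f y = f (genMulRight 𝒜 ξ n y) := rfl

/-- The unit of `A^!`, as an element of `(A^!)_0`. -/
abbrev dualOne (𝒜 : ℕ → Submodule k A) : dualComp 𝒜 0 :=
  ⟨1, Submodule.one_le.mp (pow_zero _).ge⟩

theorem exists_smul_dualOne (y : dualComp 𝒜 0) : ∃ c : k, y = c • dualOne 𝒜 := by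
  obtain ⟨y, hy⟩ := y
  rw [dualComp, pow_zero, Submodule.mem_one] at hy
  obtain ⟨c, rfl⟩ := hy
  exact ⟨c, Subtype.ext (Algebra.algebraMap_eq_smul_one c)⟩

theorem dualCoalg_zero_ext {f g : DualCoalg 𝒜 0} (h : f (dualOne 𝒜) = g (dualOne 𝒜)) :
    f = g := by
  ext y
  obtain ⟨c, rfl⟩ := exists_smul_dualOne y
  rw [map_smul, map_smul, h]

/-- There is an element of `(A^!)^*_0` with value `1` at `1`. -/
theorem exists_counit (𝒜 : ℕ → Submodule k A) :
    ∃ e : DualCoalg 𝒜 0, e (dualOne 𝒜) = 1 := by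
  let φ : QuadraticDual 𝒜 →ₐ[k] k := RingQuot.liftAlgHom k
    ⟨TensorAlgebra.lift k (0 : Module.Dual k (𝒜 1) →ₗ[k] k), by
      rintro _ _ ⟨t, ht⟩
      refine Eq.trans ?_ (map_zero (TensorAlgebra.lift k (0 : Module.Dual k (𝒜 1) →ₗ[k] k))).symm
      clear ht
      induction t using TensorProduct.induction_on with
      | zero => simp only [map_zero]
      | add y z hy hz => simp only [map_add, hy, hz, add_zero]
      | tmul ξ η =>
        rw [tensorTwo, LinearMap.comp_apply, TensorProduct.map_tmul, LinearMap.mul'_apply, map_mul,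
          TensorAlgebra.lift_ι_apply, LinearMap.zero_apply, zero_mul]⟩
  exact ⟨φ.toLinearMap ∘ₗ (dualComp 𝒜 0).subtype, map_one φ⟩

/-- An element of `(A^!)^*_{n+1}` is determined by its contractions with a basis of `V^*`. -/
theorem eq_zero_of_actRight_eq_zero (n : ℕ) (f : DualCoalg 𝒜 (n + 1))
    (hf : ∀ i, actRight 𝒜 (x.coord i) n f = 0) : f = 0 := by
  obtain ⟨e, he⟩ := exists_dual_extension (𝒜 := 𝒜) (n + 1)
  have hgen : ∀ (ξ : Module.Dual k (𝒜 1)) (y : dualComp 𝒜 n), e f (dualGen 𝒜 ξ * y) = 0 := by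
    intro ξ y
    have hξ : ξ = ∑ i, ξ (x i) • x.coord i := (x.sum_dual_apply_smul_coord ξ).symm
    rw [hξ, map_sum, Finset.sum_mul, map_sum]
    refine Finset.sum_eq_zero fun i _ => ?_
    rw [map_smul, smul_mul_assoc, map_smul, ← genMulLeft_apply, he, ← actRight_apply, hf i]
    simp
  ext y
  rw [← he]
  obtain ⟨y, hy⟩ := y
  simp only [LinearMap.zero_apply]
  rw [dualComp, pow_succ'] at hy
  induction hy using Submodule.mul_induction_on' with
  | mem_mul_mem m hm z hz =>
    obtain ⟨ξ, rfl⟩ := hm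
    exact hgen ξ ⟨z, hz⟩
  | add y _ z _ hy hz => rw [map_add, hy, hz, add_zero]

/-! ### Extending elements of the dual coalgebra -/

/-- The right action of `V^*` on the product of the components of `(A^!)^*`. -/
def contract (𝒜 : ℕ → Submodule k A) :
    Module.Dual k (𝒜 1) →ₗ[k] (∀ m, DualCoalg 𝒜 m) →ₗ[k] (∀ m, DualCoalg 𝒜 m) :=
  LinearMap.mk₂ k (fun ξ g m => actRight 𝒜 ξ m (g (m + 1)))
    (fun ξ η g => by
      ext m y
      simp only [actRight_apply, Pi.add_apply, LinearMap.add_apply, ← map_add]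
      congr 1
      ext
      simp [genMulLeft_apply, add_mul])
    (fun c ξ g => by
      ext m y
      simp only [actRight_apply, Pi.smul_apply, LinearMap.smul_apply, ← map_smul]
      congr 1
      ext
      simp [genMulLeft_apply])
    (fun ξ g h => by ext m y; simp)
    (fun c ξ g => by ext m y; simp)

theorem contract_apply (ξ : Module.Dual k (𝒜 1)) (g : ∀ m, DualCoalg 𝒜 m) (m : ℕ) :
    contract 𝒜 ξ g m = actRight 𝒜 ξ m (g (m + 1)) := rfl

theorem contract_single_zero (ξ : Module.Dual k (𝒜 1)) (f : DualCoalg 𝒜 0) :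
    contract 𝒜 ξ (Pi.single 0 f) = 0 := by
  funext m
  rw [contract_apply, Pi.single_eq_of_ne (Nat.succ_ne_zero m), map_zero, Pi.zero_apply]

theorem contract_single_succ (ξ : Module.Dual k (𝒜 1)) (n : ℕ) (f : DualCoalg 𝒜 (n + 1)) :
    contract 𝒜 ξ (Pi.single (n + 1) f) = Pi.single n (actRight 𝒜 ξ n f) := by
  funext m
  rw [contract_apply]
  by_cases hm : m = n
  · subst hm
    simp
  · rw [Pi.single_eq_of_ne (by omega), Pi.single_eq_of_ne hm, map_zero]

/-! ### A right action of `A^!` on `k ⊕ M` -/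

section ExtAction

variable {M : Type*} [AddCommGroup M] [Module k M]
  (c : Module.Dual k (𝒜 1) →ₗ[k] M →ₗ[k] M) (F : Module.Dual k (𝒜 1) →ₗ[k] M)

/-- The action of `V^*` on `k ⊕ M` which extends the action `c` on the second summand by
sending the generator of the first one to `F`. -/
def extAction : Module.Dual k (𝒜 1) →ₗ[k] (Module.End k (k × M))ᵐᵒᵖ :=
  (MulOpposite.opLinearEquiv k).toLinearMap ∘ₗ
    LinearMap.mk₂ k (fun ξ p => ((0 : k), p.1 • F ξ + c ξ p.2))
      (fun ξ η p => by
        simp only [map_add, smul_add, LinearMap.add_apply, Prod.mk_add_mk, add_zero]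
        congr 1; abel)
      (fun t ξ p => by
        simp only [map_smul, LinearMap.smul_apply, Prod.smul_mk, smul_zero, smul_add,
          smul_comm t])
      (fun ξ p q => by
        simp only [Prod.fst_add, Prod.snd_add, map_add, add_smul, Prod.mk_add_mk, add_zero]
        congr 1; abel)
      (fun t ξ p => by
        simp only [Prod.smul_fst, Prod.smul_snd, map_smul, Prod.smul_mk, smul_add,
          smul_eq_mul, mul_smul, mul_zero])

theorem unop_extAction_apply (ξ : Module.Dual k (𝒜 1)) (p : k × M) :
    (extAction c F ξ).unop p = (0, p.1 • F ξ + c ξ p.2) := rfl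

/-- The action of two successive elements of `V^*`. -/
def actTwo : Module.Dual k (𝒜 1) ⊗[k] Module.Dual k (𝒜 1) →ₗ[k] M →ₗ[k] M :=
  TensorProduct.lift (LinearMap.mk₂ k (fun ξ η => c η ∘ₗ c ξ)
    (fun ξ ξ' η => by rw [map_add, LinearMap.comp_add])
    (fun t ξ η => by rw [map_smul, LinearMap.comp_smul])
    (fun ξ η η' => by rw [map_add, LinearMap.add_comp])
    (fun t ξ η => by rw [map_smul, LinearMap.smul_comp]))

theorem actTwo_tmul (ξ η : Module.Dual k (𝒜 1)) (m : M) :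
    actTwo c (ξ ⊗ₜ η) m = c η (c ξ m) := rfl

theorem lift_extAction_tensorTwo (t : Module.Dual k (𝒜 1) ⊗[k] Module.Dual k (𝒜 1)) (p : k × M) :
    (TensorAlgebra.lift k (extAction c F) (tensorTwo 𝒜 t)).unop p =
      (0, p.1 • (∑ i, ∑ j, TensorProduct.dualDistrib k (𝒜 1) (𝒜 1) t (x i ⊗ₜ x j) •
        c (x.coord j) (F (x.coord i))) + actTwo c t p.2) := by
  induction t using TensorProduct.induction_on with
  | zero =>
    simp only [map_zero, MulOpposite.unop_zero, LinearMap.zero_apply, zero_smul,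
      Finset.sum_const_zero, smul_zero, zero_add]
    rfl
  | add y z hy hz =>
    simp only [map_add, MulOpposite.unop_add, LinearMap.add_apply, hy, hz, Prod.mk_add_mk,
      add_zero, add_smul, Finset.sum_add_distrib, smul_add]
    congr 1
    simp only [Finset.smul_sum]
    abel
  | tmul ξ η =>
    have h1 : c η (F ξ) = ∑ i, ∑ j,
        TensorProduct.dualDistrib k (𝒜 1) (𝒜 1) (ξ ⊗ₜ η) (x i ⊗ₜ x j) •
          c (x.coord j) (F (x.coord i)) := by
      conv_lhs => rw [← x.sum_dual_apply_smul_coord η, ← x.sum_dual_apply_smul_coord ξ]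
      simp only [map_sum, map_smul, LinearMap.sum_apply, LinearMap.smul_apply,
        TensorProduct.dualDistrib_apply, Finset.smul_sum, mul_smul]
    rw [← h1, actTwo_tmul]
    simp only [tensorTwo, LinearMap.comp_apply, TensorProduct.map_tmul, LinearMap.mul'_apply,
      map_mul, TensorAlgebra.lift_ι_apply, MulOpposite.unop_mul, Module.End.mul_apply,
      unop_extAction_apply, map_add, map_smul, zero_smul, zero_add]

/-- A relation `t` sends `(s, m)` to `(0, s • ∑ t(x_i, x_j) c(x_j^*)(F(x_i^*)) + m t)`. The second
term vanishes by `hc`; the first by `hF`, since `t(x_i, x_j) = θ(x_i x_j)` for some `θ`. The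
opposite endomorphism ring appears because the action is on the right. -/
theorem exists_algHom_extAction
    (hc : ∀ t ∈ quadRelPerp 𝒜, actTwo c t = 0)
    (hF : ∀ θ : Module.Dual k A,
      ∑ i, ∑ j, θ (x i * x j : A) • c (x.coord j) (F (x.coord i)) = 0) :
    ∃ Φ : QuadraticDual 𝒜 →ₐ[k] (Module.End k (k × M))ᵐᵒᵖ,
      ∀ ξ, Φ (dualGen 𝒜 ξ) = extAction c F ξ := by
  refine ⟨RingQuot.liftAlgHom k ⟨TensorAlgebra.lift k (extAction c F), ?_⟩, fun ξ => ?_⟩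
  · rintro _ _ ⟨t, ht⟩
    rw [map_zero]
    apply MulOpposite.unop_injective
    refine LinearMap.ext fun p => ?_
    rw [lift_extAction_tensorTwo x, hc t ht]
    obtain ⟨θ, hθ⟩ := exists_functional_of_mem_quadRelPerp ht
    simp only [hθ, hF, smul_zero, zero_add, LinearMap.zero_apply]
    rfl
  · rw [dualGen, LinearMap.comp_apply, AlgHom.toLinearMap_apply, RingQuot.liftAlgHom_mkAlgHom_apply,
      TensorAlgebra.lift_ι_apply]

end ExtAction

/-- Contracting twice evaluates at a product: `(g ξ η)(y) = g(ξ η y)`. Thus relations of `A^!` act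
by zero on `(A^!)^*`. -/
theorem actTwo_contract_apply (m : ℕ) {e : DualCoalg 𝒜 (m + 1 + 1) → Module.Dual k (QuadraticDual 𝒜)}
    (he : ∀ f (y : dualComp 𝒜 (m + 1 + 1)), e f y = f y)
    (t : Module.Dual k (𝒜 1) ⊗[k] Module.Dual k (𝒜 1)) (g : ∀ m, DualCoalg 𝒜 m)
    (y : dualComp 𝒜 m) :
    actTwo (contract 𝒜) t g m y = e (g (m + 1 + 1))
      (RingQuot.mkAlgHom k (QuadraticDualRel 𝒜) (tensorTwo 𝒜 t) * (y : QuadraticDual 𝒜)) := by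
  induction t using TensorProduct.induction_on with
  | zero =>
    rw [map_zero, map_zero, map_zero, zero_mul, map_zero]
    rfl
  | add u v hu hv =>
    rw [map_add, map_add, map_add, add_mul, map_add, ← hu, ← hv]
    rfl
  | tmul ξ η =>
    rw [actTwo_tmul, contract_apply, contract_apply, actRight_apply, actRight_apply, ← he,
      genMulLeft_apply, genMulLeft_apply, mkAlgHom_tensorTwo_tmul, mul_assoc]

theorem actTwo_contract_eq_zero {t : Module.Dual k (𝒜 1) ⊗[k] Module.Dual k (𝒜 1)}
    (ht : t ∈ quadRelPerp 𝒜) : actTwo (contract 𝒜) t = 0 := by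
  refine LinearMap.ext fun g => funext fun m => LinearMap.ext fun y => ?_
  obtain ⟨e, he⟩ := exists_dual_extension (𝒜 := 𝒜) (m + 1 + 1)
  rw [actTwo_contract_apply m he, mkAlgHom_tensorTwo_eq_zero ht, zero_mul, map_zero]
  rfl

/-- Acting on `p` and evaluating the component of degree `0` at `1`. -/
def evalAct (Φ : QuadraticDual 𝒜 →ₐ[k] (Module.End k (k × ∀ m, DualCoalg 𝒜 m))ᵐᵒᵖ)
    (p : k × ∀ m, DualCoalg 𝒜 m) : Module.Dual k (QuadraticDual 𝒜) :=
  Module.Dual.eval k _ (dualOne 𝒜) ∘ₗ LinearMap.proj 0 ∘ₗ LinearMap.snd k k _ ∘ₗ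
    LinearMap.applyₗ p ∘ₗ (MulOpposite.opLinearEquiv k).symm.toLinearMap ∘ₗ Φ.toLinearMap

theorem evalAct_apply (Φ : QuadraticDual 𝒜 →ₐ[k] (Module.End k (k × ∀ m, DualCoalg 𝒜 m))ᵐᵒᵖ)
    (p : k × ∀ m, DualCoalg 𝒜 m) (y : QuadraticDual 𝒜) :
    evalAct Φ p y = ((Φ y).unop p).2 0 (dualOne 𝒜) := rfl

theorem evalAct_mul (F : Module.Dual k (𝒜 1) →ₗ[k] ∀ m, DualCoalg 𝒜 m)
    {Φ : QuadraticDual 𝒜 →ₐ[k] (Module.End k (k × ∀ m, DualCoalg 𝒜 m))ᵐᵒᵖ}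
    (hΦ : ∀ ξ, Φ (dualGen 𝒜 ξ) = extAction (contract 𝒜) F ξ) (p : k × ∀ m, DualCoalg 𝒜 m)
    (ξ : Module.Dual k (𝒜 1)) (y : QuadraticDual 𝒜) :
    evalAct Φ p (dualGen 𝒜 ξ * y) = evalAct Φ (0, p.1 • F ξ + contract 𝒜 ξ p.2) y := by
  have h1 : (Φ (dualGen 𝒜 ξ * y)).unop p = (Φ y).unop ((extAction (contract 𝒜) F ξ).unop p) := by
    rw [map_mul Φ, hΦ ξ]
    rfl
  rw [evalAct_apply, evalAct_apply, h1]
  rfl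

/-- On the summand `M` the action is contraction, so peeling generators off `y` from the left leaves
in degree `0` the functional with value `g_m(y)` at `1`. -/
theorem extAction_contract_eval {F : Module.Dual k (𝒜 1) →ₗ[k] ∀ m, DualCoalg 𝒜 m}
    {Φ : QuadraticDual 𝒜 →ₐ[k] (Module.End k (k × ∀ m, DualCoalg 𝒜 m))ᵐᵒᵖ}
    (hΦ : ∀ ξ, Φ (dualGen 𝒜 ξ) = extAction (contract 𝒜) F ξ) (m : ℕ) (y : dualComp 𝒜 m)
    (g : ∀ m, DualCoalg 𝒜 m) :
    evalAct Φ (0, g) y = g m y := by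
  induction m generalizing g with
  | zero =>
    obtain ⟨c, rfl⟩ := exists_smul_dualOne y
    have : ((Φ 1).unop (0, g)).2 0 (dualOne 𝒜) = g 0 (dualOne 𝒜) := by rw [map_one]; rfl
    rw [Submodule.coe_smul, map_smul, map_smul, ← this]
    rfl
  | succ m ih =>
    obtain ⟨y, hy⟩ := y
    obtain ⟨e, he⟩ := exists_dual_extension (𝒜 := 𝒜) (m + 1)
    rw [← he]
    simp only
    rw [dualComp, pow_succ'] at hy
    induction hy using Submodule.mul_induction_on' with
    | mem_mul_mem z hz y hy =>
      obtain ⟨ξ, rfl⟩ := hz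
      rw [evalAct_mul F hΦ, zero_smul, zero_add, ih ⟨y, hy⟩, contract_apply, actRight_apply, ← he,
        genMulLeft_apply]
    | add y _ z _ hy hz => rw [map_add (evalAct Φ (0, g)) y z, hy, hz, map_add (e (g (m + 1))) y z]

/-- Adjoin to `(A^!)^*` a formal vector `(1, 0)` with `(1, 0) x_i^* = f_i`. The hypothesis says
precisely that the relations of `A^!` kill it, so `A^!` acts. The required `g` sends `y` to the
value at `1` of the degree `0` part of `(1, 0) y`. -/
theorem exists_actRight_eq_of_contract (n : ℕ) (f : ι → DualCoalg 𝒜 n)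
    (hf : ∀ θ : Module.Dual k A,
      ∑ i, ∑ j, θ (x i * x j : A) • contract 𝒜 (x.coord j) (Pi.single n (f i)) = 0) :
    ∃ g : DualCoalg 𝒜 (n + 1), ∀ i, actRight 𝒜 (x.coord i) n g = f i := by
  classical
  let F : Module.Dual k (𝒜 1) →ₗ[k] ∀ m, DualCoalg 𝒜 m :=
    LinearMap.single k (DualCoalg 𝒜) n ∘ₗ
      ∑ i, (LinearMap.toSpanSingleton k _ (f i)) ∘ₗ Module.Dual.eval k (𝒜 1) (x i)
  have hFx : ∀ i, F (x.coord i) = Pi.single n (f i) := by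
    intro i
    simp [F, Finsupp.single_apply]
  obtain ⟨Φ, hΦ⟩ := exists_algHom_extAction x (contract 𝒜) F
    (fun t ht => actTwo_contract_eq_zero ht) (by simpa only [hFx] using hf)
  refine ⟨evalAct Φ (1, 0) ∘ₗ (dualComp 𝒜 (n + 1)).subtype, fun i => LinearMap.ext fun y => ?_⟩
  rw [actRight_apply, LinearMap.comp_apply, Submodule.subtype_apply, genMulLeft_apply,
    evalAct_mul F hΦ, map_zero, add_zero, one_smul, extAction_contract_eval hΦ n y, hFx,
    Pi.single_eq_same]

theorem exists_actRight_eq_zero (f : ι → DualCoalg 𝒜 0) :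
    ∃ g : DualCoalg 𝒜 1, ∀ i, actRight 𝒜 (x.coord i) 0 g = f i :=
  exists_actRight_eq_of_contract x 0 f fun θ => by simp [contract_single_zero]

theorem exists_actRight_eq_succ (n : ℕ) (f : ι → DualCoalg 𝒜 (n + 1))
    (hf : ∀ θ : Module.Dual k A,
      ∑ i, ∑ j, θ (x i * x j : A) • actRight 𝒜 (x.coord j) n (f i) = 0) :
    ∃ g : DualCoalg 𝒜 (n + 1 + 1), ∀ i, actRight 𝒜 (x.coord i) (n + 1) g = f i := by
  refine exists_actRight_eq_of_contract x (n + 1) f fun θ => ?_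
  have := congrArg (LinearMap.single k (DualCoalg 𝒜) n) (hf θ)
  simpa only [map_sum, map_smul, map_zero, LinearMap.single_apply, contract_single_succ]
    using this

end QuadraticDual

end

end KoszulPowers

namespace KoszulPowers

noncomputable section

universe u v w

/-! ### Graded free modules generated in one degree -/

section Projections

variable {X : Type*} [AddCommGroup X] {gr : ℕ → AddSubgroup X}

/-- The projection of a graded group onto a homogeneous component. -/
def gradedProj (h : DirectSum.IsInternal gr) (e : ℕ) : X →+ X :=
  letI := h.chooseDecomposition
  (gr e).subtype.comp ((DirectSum.component ℤ ℕ (fun i => gr i) e).toAddMonoidHom.comp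
    (DirectSum.decomposeAddEquiv gr).toAddMonoidHom)

theorem gradedProj_mem (h : DirectSum.IsInternal gr) (e : ℕ) (y : X) :
    gradedProj h e y ∈ gr e :=
  SetLike.coe_mem _

theorem gradedProj_of_mem (h : DirectSum.IsInternal gr) {e : ℕ} {y : X} (hy : y ∈ gr e) :
    gradedProj h e y = y :=
  letI := h.chooseDecomposition
  DirectSum.decompose_of_mem_same gr hy

theorem gradedProj_of_mem_ne (h : DirectSum.IsInternal gr) {e e' : ℕ} {y : X} (hy : y ∈ gr e)
    (hne : e ≠ e') : gradedProj h e' y = 0 :=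
  letI := h.chooseDecomposition
  DirectSum.decompose_of_mem_ne gr hy hne

theorem graded_induction (h : DirectSum.IsInternal gr) {p : X → Prop} (h0 : p 0)
    (hgr : ∀ e, ∀ y ∈ gr e, p y) (hadd : ∀ y z, p y → p z → p (y + z)) (y : X) : p y :=
  letI := h.chooseDecomposition
  DirectSum.Decomposition.inductionOn gr h0 (fun m => hgr _ _ m.2) hadd y

end Projections

/-! ### Homogeneous bases and their coordinates -/

section GradedModule

variable {k : Type v} {A : Type u} [Field k] [Ring A] [Algebra k A]
  {𝒜 : ℕ → Submodule k A} [GradedAlgebra 𝒜]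
  {X : Type*} [AddCommGroup X] [Module A X] {gr : ℕ → AddSubgroup X}

theorem IsGradedModule.gradedProj_smul (h : IsGradedModule 𝒜 gr) (e : ℕ) (r : A) {j : ℕ} {y : X}
    (hy : y ∈ gr j) :
    gradedProj h.isInternal e (r • y) =
      if j ≤ e then (DirectSum.decompose 𝒜 r (e - j) : A) • y else 0 := by
  induction r using DirectSum.Decomposition.inductionOn 𝒜 with
  | zero => simp
  | @homogeneous i r =>
    have hr := h.smul_mem r.2 hy
    by_cases he : i + j = e
    · rw [if_pos (by omega), ← he, gradedProj_of_mem h.isInternal hr, Nat.add_sub_cancel,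
        DirectSum.decompose_of_mem_same 𝒜 r.2]
    · rw [gradedProj_of_mem_ne h.isInternal hr he]
      split_ifs with hj
      · rw [DirectSum.decompose_of_mem_ne 𝒜 r.2 (by omega), zero_smul]
      · rfl
  | add r s hr hs =>
    rw [add_smul, map_add, hr, hs, DirectSum.decompose_add, DirectSum.add_apply,
      Submodule.coe_add, add_smul]
    split_ifs <;> simp

theorem IsGradedModule.eq_zero_of_lt (h : IsGradedModule 𝒜 gr) {m e : ℕ}
    (hspan : Submodule.span A (gr m : Set X) = ⊤) (he : e < m) {y : X} (hy : y ∈ gr e) :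
    y = 0 := by
  have key : ∀ z ∈ Submodule.span A (gr m : Set X), ∀ r : A,
      gradedProj h.isInternal e (r • z) = 0 := by
    intro z hz
    induction hz using Submodule.span_induction with
    | mem z hz => intro r; rw [h.gradedProj_smul e r hz, if_neg (by omega)]
    | zero => intro r; rw [smul_zero, map_zero]
    | add y z _ _ hy hz => intro r; rw [smul_add, map_add, hy, hz, add_zero]
    | smul s y _ hy => intro r; rw [← mul_smul, hy]
  rw [← gradedProj_of_mem h.isInternal hy, ← one_smul A y]
  exact key y (hspan ▸ Submodule.mem_top) 1

variable {ι : Type*} (b : Module.Basis ι A X)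

theorem IsGradedModule.repr_gradedProj (h : IsGradedModule 𝒜 gr) {dg : ι → ℕ}
    (hb : ∀ i, b i ∈ gr (dg i)) (e : ℕ) (y : X) (i : ι) :
    b.repr (gradedProj h.isInternal e y) i =
      if dg i ≤ e then (DirectSum.decompose 𝒜 (b.repr y i) (e - dg i) : A) else 0 := by
  classical
  obtain ⟨f, rfl⟩ := b.repr.symm.surjective y
  rw [LinearEquiv.apply_symm_apply]
  induction f using Finsupp.induction_linear with
  | zero => simp
  | add f g hf hg =>
    rw [map_add, map_add, map_add, Finsupp.add_apply, hf, hg, Finsupp.add_apply,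
      DirectSum.decompose_add, DirectSum.add_apply, Submodule.coe_add]
    split_ifs <;> simp
  | single l r =>
    rw [Module.Basis.repr_symm_single, h.gradedProj_smul e r (hb l)]
    by_cases hl : l = i
    · subst hl
      split_ifs <;> simp
    · split_ifs <;> simp [hl]

/-- If `b i` had degree other than `m`, the `i`-th coordinate of each element of degree `m` would be
zero or of positive degree, so in `𝔪`. As degree `m` generates, the same would hold for `b i`, whose
coordinate is `1`. -/
theorem IsGradedModule.basis_mem (h : IsGradedModule 𝒜 gr) [Nontrivial A] {m : ℕ}
    (hspan : Submodule.span A (gr m : Set X) = ⊤) (hb : ∀ i, ∃ j, b i ∈ gr j) (i : ι) :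
    b i ∈ gr m := by
  choose dg hdg using hb
  by_cases hm : dg i = m
  · exact hm ▸ hdg i
  exfalso
  have key : ∀ y ∈ Submodule.span A (gr m : Set X), b.repr y i ∈ maxIdeal 𝒜 := by
    intro y hy
    induction hy using Submodule.span_induction with
    | mem z hz =>
      rw [← gradedProj_of_mem h.isInternal hz, h.repr_gradedProj b hdg]
      split_ifs with hle
      · exact mem_maxIdeal_of_mem (by omega) (SetLike.coe_mem _)
      · exact zero_mem _
    | zero => simp
    | add y z _ _ hy hz =>
      rw [map_add, Finsupp.add_apply]
      exact add_mem hy hz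
    | smul r y _ hy =>
      rw [map_smul, Finsupp.smul_apply]
      exact Ideal.mul_mem_left _ r hy
  have h1 := key (b i) (hspan ▸ Submodule.mem_top)
  rw [Module.Basis.repr_self, Finsupp.single_eq_same, mem_maxIdeal_iff,
    DirectSum.decompose_of_mem_same 𝒜 (SetLike.one_mem_graded 𝒜)] at h1
  exact one_ne_zero h1

theorem IsGradedModule.repr_mem (h : IsGradedModule 𝒜 gr) {m : ℕ} (hb : ∀ i, b i ∈ gr m)
    {j : ℕ} {y : X} (hy : y ∈ gr (m + j)) (i : ι) : b.repr y i ∈ 𝒜 j := by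
  rw [← gradedProj_of_mem h.isInternal hy, h.repr_gradedProj b hb, if_pos (by omega),
    Nat.add_sub_cancel_left]
  exact SetLike.coe_mem _

theorem gradedProj_map {Y : Type*} [AddCommGroup Y] {grY : ℕ → AddSubgroup Y}
    (hX : DirectSum.IsInternal gr) (hY : DirectSum.IsInternal grY) (f : X →+ Y)
    (hf : ∀ e y, y ∈ gr e → f y ∈ grY e) (e : ℕ) (y : X) :
    gradedProj hY e (f y) = f (gradedProj hX e y) := by
  refine graded_induction (p := fun y => gradedProj hY e (f y) = f (gradedProj hX e y)) hX
    ?_ (fun i y hy => ?_) (fun y z hy hz => ?_) y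
  · simp
  · by_cases hi : i = e
    · subst hi
      rw [gradedProj_of_mem hX hy, gradedProj_of_mem hY (hf _ _ hy)]
    · rw [gradedProj_of_mem_ne hX hy hi, gradedProj_of_mem_ne hY (hf _ _ hy) hi, map_zero]
  · simp only [map_add, hy, hz]

end GradedModule

/-! ### Comparing a linear resolution with the Koszul complex -/

section Step

variable {k : Type v} {A : Type u} [Field k] [Ring A] [Algebra k A]
  {𝒜 : ℕ → Submodule k A} [GradedAlgebra 𝒜]

/-- The homogeneous component `A_j ⊗ W` of `A ⊗ W`. -/
def tensorComp (𝒜 : ℕ → Submodule k A) (j : ℕ) (W : Type*) [AddCommGroup W] [Module k W] :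
    Submodule k (A ⊗[k] W) :=
  LinearMap.range ((𝒜 j).subtype.rTensor W)

theorem tmul_mem_tensorComp {j : ℕ} {r : A} (hr : r ∈ 𝒜 j) {W : Type*} [AddCommGroup W]
    [Module k W] (w : W) : r ⊗ₜ[k] w ∈ tensorComp 𝒜 j W :=
  ⟨(⟨r, hr⟩ : 𝒜 j) ⊗ₜ w, rfl⟩

/-- Let `Q'' → Q' → Q` be exact, with `Q'` graded free and generated in degree `m`, and `Q''`
generated in degree `m + 1`. If the degree `m` part of the image of `Q' → Q` is isomorphic to
`W` through a map `D : A ⊗ W → Q`, then `Q'` is isomorphic to `A ⊗ W`. -/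
theorem exists_equiv_tensor (hA : IsStandardGraded 𝒜)
    {Q'' Q' Q T : Type*} [AddCommGroup Q''] [AddCommGroup Q'] [AddCommGroup Q] [AddCommGroup T]
    [Module A Q''] [Module A Q'] [Module A Q] [Module A T]
    {gr'' : ℕ → AddSubgroup Q''} {gr' : ℕ → AddSubgroup Q'} {gr : ℕ → AddSubgroup Q}
    (h'' : IsGradedModule 𝒜 gr'') (h' : IsGradedFree 𝒜 gr') (h : IsGradedModule 𝒜 gr) {m : ℕ}
    (hspan'' : Submodule.span A (gr'' (m + 1) : Set Q'') = ⊤)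
    (hspan' : Submodule.span A (gr' m : Set Q') = ⊤)
    {d' : Q'' →ₗ[A] Q'} {d : Q' →ₗ[A] Q} (hd' : ∀ e y, y ∈ gr'' e → d' y ∈ gr' e)
    (hd : ∀ e y, y ∈ gr' e → d y ∈ gr e) (hexact : Function.Exact d' d)
    (θ : Q ≃ₗ[A] T) {W : Type*} [AddCommGroup W] [Module k W] (D : A ⊗[k] W →ₗ[A] T)
    (hinj : ∀ w, D (1 ⊗ₜ w) = 0 → w = 0)
    (hrange : ∀ w, θ.symm (D (1 ⊗ₜ w)) ∈ gr m ∧ θ.symm (D (1 ⊗ₜ w)) ∈ LinearMap.range d)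
    (hsurj : ∀ y ∈ gr m, y ∈ LinearMap.range d → ∃ w, D (1 ⊗ₜ w) = θ y) :
    ∃ θ' : Q' ≃ₗ[A] A ⊗[k] W, (∀ y, D (θ' y) = θ (d y)) ∧
      ∀ j y, y ∈ gr' (m + j) ↔ θ' y ∈ tensorComp 𝒜 j W := by
  have := hA.nontrivial
  obtain ⟨ι, b, hb⟩ := h'.exists_basis
  replace hb := h'.toIsGradedModule.basis_mem b hspan' hb
  -- A preimage of `y` in `Q''` may be replaced by its degree `m` part, which is zero because `Q''`
  -- starts in degree `m + 1`.
  have hdinj : ∀ y ∈ gr' m, d y = 0 → y = 0 := by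
    intro y hy hy0
    obtain ⟨z, rfl⟩ := (hexact y).1 hy0
    have h0 := h''.eq_zero_of_lt hspan'' (Nat.lt_succ_self m) (gradedProj_mem h''.isInternal m z)
    rw [← gradedProj_of_mem h'.isInternal hy]
    have := gradedProj_map h''.isInternal h'.isInternal d'.toAddMonoidHom hd' m z
    simp only [LinearMap.toAddMonoidHom_coe] at this
    rw [this, h0, map_zero]
  -- The vectors `W' i` turn out to be a basis of `W`: independent since `d` is injective in degree
  -- `m`, spanning since every `D (1 ⊗ w)` is hit from degree `m`, where coordinates lie in `A_0 =
  -- k`.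
  choose W' hW' using fun i => hsurj (d (b i)) (hd _ _ (hb i)) ⟨b i, rfl⟩
  have hcomb : ∀ c : ι →₀ k, D (1 ⊗ₜ Finsupp.linearCombination k W' c) =
      θ (d (c.sum fun i t => algebraMap k A t • b i)) := by
    intro c
    rw [Finsupp.linearCombination_apply, Finsupp.sum, Finsupp.sum, TensorProduct.tmul_sum,
      map_sum, map_sum, map_sum]
    refine Finset.sum_congr rfl fun i _ => ?_
    rw [map_smul, map_smul, ← hW', ← map_smul, TensorProduct.tmul_smul, TensorProduct.smul_tmul',
      TensorProduct.smul_tmul', Algebra.smul_def, smul_eq_mul]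
  have hmem : ∀ c : ι →₀ k, (c.sum fun i t => algebraMap k A t • b i) ∈ gr' m := by
    intro c
    refine sum_mem fun i _ => ?_
    have := h'.smul_mem (SetLike.algebraMap_mem_graded 𝒜 (c i)) (hb i)
    rwa [zero_add] at this
  have hrepr : ∀ (c : ι →₀ k) i,
      b.repr (c.sum fun i t => algebraMap k A t • b i) i = algebraMap k A (c i) := by
    intro c i
    classical
    rw [Finsupp.sum, map_sum, Finsupp.finsetSum_apply]
    simp only [map_smul, Module.Basis.repr_self, Finsupp.smul_single, smul_eq_mul, mul_one,
      Finsupp.single_apply]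
    rw [Finset.sum_ite_eq']
    split_ifs with hi
    · rfl
    · rw [Finsupp.notMem_support_iff.1 hi, map_zero]
  have hli : LinearIndependent k W' := by
    rw [linearIndependent_iff]
    intro c hc
    have h1 := hcomb c
    rw [hc, TensorProduct.tmul_zero, map_zero, eq_comm, LinearEquiv.map_eq_zero_iff] at h1
    ext i
    have h2 := hrepr c i
    rw [hdinj _ (hmem c) h1, map_zero, Finsupp.zero_apply, eq_comm,
      map_eq_zero_iff _ hA.algebraMap_injective] at h2
    rw [h2, Finsupp.zero_apply]
  have hsp : ⊤ ≤ Submodule.span k (Set.range W') := by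
    intro w _
    obtain ⟨h1, u, hu⟩ := hrange w
    have h2 : d (gradedProj h'.isInternal m u) = θ.symm (D (1 ⊗ₜ w)) := by
      have := gradedProj_map h'.isInternal h.isInternal d.toAddMonoidHom hd m u
      simp only [LinearMap.toAddMonoidHom_coe] at this
      rw [← this, hu, gradedProj_of_mem h.isInternal h1]
    set u' := gradedProj h'.isInternal m u
    have hu' : u' ∈ gr' (m + 0) := gradedProj_mem h'.isInternal m u
    let c : ι →₀ k := (b.repr u').mapRange (coeffZero hA) (map_zero _)
    have hc : (c.sum fun i t => algebraMap k A t • b i) = u' := by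
      apply b.repr.injective
      ext i
      rw [hrepr, Finsupp.mapRange_apply,
        algebraMap_coeffZero_of_mem hA (h'.repr_mem b hb hu' i)]
    have h3 := hcomb c
    rw [hc, h2, LinearEquiv.apply_symm_apply, ← sub_eq_zero, ← map_sub, ← TensorProduct.tmul_sub]
      at h3
    rw [← sub_eq_zero.1 (hinj _ h3)]
    rw [← Finsupp.range_linearCombination]
    exact LinearMap.mem_range_self _ _
  let bW := Module.Basis.mk hli hsp
  let θ' : Q' ≃ₗ[A] A ⊗[k] W := b.equiv (Algebra.TensorProduct.basis A bW) (Equiv.refl ι)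
  have hθ' : ∀ i, θ' (b i) = 1 ⊗ₜ W' i := by
    intro i
    simp [θ', bW]
  refine ⟨θ', fun y => ?_, fun j y => ⟨fun hy => ?_, ?_⟩⟩
  · have : D ∘ₗ θ'.toLinearMap = θ.toLinearMap ∘ₗ d := by
      refine b.ext fun i => ?_
      simp only [LinearMap.comp_apply, LinearEquiv.coe_coe, hθ', hW']
    exact LinearMap.congr_fun this y
  · rw [← b.linearCombination_repr y, Finsupp.linearCombination_apply, Finsupp.sum, map_sum]
    refine sum_mem fun i _ => ?_
    rw [map_smul, hθ', TensorProduct.smul_tmul', smul_eq_mul, mul_one]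
    exact tmul_mem_tensorComp (h'.repr_mem b hb hy i) _
  · rintro ⟨z, hz⟩
    rw [← θ'.symm_apply_apply y, ← hz]
    clear hz
    induction z using TensorProduct.induction_on with
    | zero => rw [map_zero, map_zero]; exact zero_mem _
    | add y z hy hz => rw [map_add, map_add]; exact add_mem hy hz
    | tmul r w =>
      rw [LinearMap.rTensor_tmul]
      have hw : w ∈ Submodule.span k (Set.range W') := hsp trivial
      induction hw using Submodule.span_induction with
      | mem w hw =>
        obtain ⟨i, rfl⟩ := hw
        have h1 : (𝒜 j).subtype r ⊗ₜ[k] W' i = θ' ((r : A) • b i) := by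
          rw [map_smul, hθ', TensorProduct.smul_tmul', smul_eq_mul, mul_one]
          rfl
        rw [h1, LinearEquiv.symm_apply_apply, add_comm]
        exact h'.smul_mem r.2 (hb i)
      | zero => rw [TensorProduct.tmul_zero, map_zero]; exact zero_mem _
      | add y z _ _ hy hz => rw [TensorProduct.tmul_add, map_add]; exact add_mem hy hz
      | smul c y _ hy =>
        have h1 : (𝒜 j).subtype r ⊗ₜ[k] (c • y) =
            algebraMap k A c • ((𝒜 j).subtype r ⊗ₜ[k] y) := by
          rw [TensorProduct.tmul_smul, TensorProduct.smul_tmul', TensorProduct.smul_tmul',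
            Algebra.smul_def, smul_eq_mul]
        rw [h1, map_smul]
        have := h'.smul_mem (SetLike.algebraMap_mem_graded 𝒜 c) hy
        rwa [zero_add] at this

end Step

end

end KoszulPowers

namespace KoszulPowers

noncomputable section

universe u v w

/-! ### The left Koszul complex -/

section LeftKoszul

variable {k : Type v} {A : Type u} [Field k] [Ring A] [Algebra k A]
  {𝒜 : ℕ → Submodule k A}
  {ι : Type*} [Fintype ι] (x : Module.Basis ι k (𝒜 1))

/-- The differential `r ⊗ f ↦ ∑ r x_i ⊗ f x_i^*` of the left Koszul complex `A ⊗ (A^!)^*`. -/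
def leftKoszul (n : ℕ) : A ⊗[k] DualCoalg 𝒜 (n + 1) →ₗ[A] A ⊗[k] DualCoalg 𝒜 n :=
  ∑ i, TensorProduct.AlgebraTensorModule.map
    (LinearMap.toSpanSingleton A A (x i : A)) (actRight 𝒜 (x.coord i) n)

theorem leftKoszul_tmul (n : ℕ) (r : A) (f : DualCoalg 𝒜 (n + 1)) :
    leftKoszul x n (r ⊗ₜ f) = ∑ i, (r * (x i : A)) ⊗ₜ[k] actRight 𝒜 (x.coord i) n f := by
  simp [leftKoszul, LinearMap.sum_apply]

/-- On `r ⊗ f` the double differential is the image of `∑ x_i x_j ⊗ x_i^* x_j^* = 0` under left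
multiplication by `r` tensored with `ψ : u ↦ (y ↦ f(u y))`. -/
theorem leftKoszul_leftKoszul (n : ℕ) (z : A ⊗[k] DualCoalg 𝒜 (n + 1 + 1)) :
    leftKoszul x n (leftKoszul x (n + 1) z) = 0 := by
  induction z using TensorProduct.induction_on with
  | zero => simp only [map_zero]
  | add y z hy hz => simp only [map_add, hy, hz, add_zero]
  | tmul r f =>
    obtain ⟨e, he⟩ := exists_dual_extension (𝒜 := 𝒜) (n + 1 + 1)
    let ψ : QuadraticDual 𝒜 →ₗ[k] DualCoalg 𝒜 n :=
      ((LinearMap.mul k (QuadraticDual 𝒜)).compr₂ (e f)).compl₂ (dualComp 𝒜 n).subtype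
    have hψ : ∀ i j, actRight 𝒜 (x.coord j) n (actRight 𝒜 (x.coord i) (n + 1) f) =
        ψ (dualGen 𝒜 (x.coord i) * dualGen 𝒜 (x.coord j)) := by
      intro i j
      ext y
      rw [actRight_apply, actRight_apply, ← he, genMulLeft_apply, genMulLeft_apply, ← mul_assoc]
      rfl
    have := congrArg (TensorProduct.map (LinearMap.mulLeft k r) ψ) (sum_tmul_dualGen_mul x)
    simp only [map_sum, map_zero, TensorProduct.map_tmul, LinearMap.mulLeft_apply, ← hψ] at this
    simp only [leftKoszul_tmul, map_sum, mul_assoc]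
    exact this

theorem exists_functional_basis [DecidableEq ι] (j : ι) :
    ∃ θ : Module.Dual k A, ∀ i, θ (x i : A) = if i = j then 1 else 0 := by
  obtain ⟨θ, hθ⟩ := LinearMap.exists_extend (x.coord j)
  refine ⟨θ, fun i => ?_⟩
  have := LinearMap.congr_fun hθ (x i)
  rw [LinearMap.comp_apply, Submodule.subtype_apply] at this
  rw [this, Module.Basis.coord_apply, Module.Basis.repr_self, Finsupp.single_apply]

theorem eq_zero_of_sum_basis_tmul {W : Type*} [AddCommGroup W] [Module k W] {f : ι → W}
    (h : ∑ i, (x i : A) ⊗ₜ[k] f i = 0) (i : ι) : f i = 0 := by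
  classical
  obtain ⟨θ, hθ⟩ := exists_functional_basis x i
  have := congrArg (fun z => TensorProduct.lid k W (θ.rTensor W z)) h
  simpa [hθ] using this

theorem exists_sum_basis_tmul {W : Type*} [AddCommGroup W] [Module k W] {z : A ⊗[k] W}
    (hz : z ∈ tensorComp 𝒜 1 W) : ∃ f : ι → W, z = ∑ i, (x i : A) ⊗ₜ[k] f i := by
  obtain ⟨z, rfl⟩ := hz
  induction z using TensorProduct.induction_on with
  | zero => exact ⟨0, by simp⟩
  | add y z hy hz =>
    obtain ⟨f, hf⟩ := hy
    obtain ⟨g, hg⟩ := hz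
    exact ⟨f + g, by simp only [map_add, hf, hg, Pi.add_apply, TensorProduct.tmul_add,
      Finset.sum_add_distrib]⟩
  | tmul r w =>
    refine ⟨fun i => x.repr r i • w, ?_⟩
    rw [LinearMap.rTensor_tmul, Submodule.subtype_apply]
    conv_lhs => rw [← x.sum_repr r]
    simp only [TensorProduct.tmul_smul, TensorProduct.smul_tmul', TensorProduct.sum_tmul,
      Submodule.coe_sum, Submodule.coe_smul]

theorem leftKoszul_injective (n : ℕ) {f : DualCoalg 𝒜 (n + 1)}
    (hf : leftKoszul x n (1 ⊗ₜ f) = 0) : f = 0 := by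
  simp only [leftKoszul_tmul, one_mul] at hf
  exact eq_zero_of_actRight_eq_zero x n f (eq_zero_of_sum_basis_tmul x hf)

/-- The map `A ⊗ (A^!)^*_0 → A`, `r ⊗ f ↦ f(1) r`. -/
def counitMap (𝒜 : ℕ → Submodule k A) : A ⊗[k] DualCoalg 𝒜 0 →ₗ[A] A :=
  (TensorProduct.AlgebraTensorModule.rid k A A).toLinearMap ∘ₗ
    TensorProduct.AlgebraTensorModule.map LinearMap.id (Module.Dual.eval k _ (dualOne 𝒜))

theorem counitMap_tmul (r : A) (f : DualCoalg 𝒜 0) :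
    counitMap 𝒜 (r ⊗ₜ f) = f (dualOne 𝒜) • r := by
  simp [counitMap]

variable [GradedAlgebra 𝒜]

/-- The cycles of the left Koszul complex, augmented by `A ⊗ (A^!)^*_0 → k`. -/
def koszulCycles : ∀ n, Submodule A (A ⊗[k] DualCoalg 𝒜 n)
  | 0 => Submodule.comap (counitMap 𝒜) (maxIdeal 𝒜)
  | n + 1 => LinearMap.ker (leftKoszul x n)

theorem leftKoszul_mem_koszulCycles (n : ℕ) (z : A ⊗[k] DualCoalg 𝒜 (n + 1)) :
    leftKoszul x n z ∈ koszulCycles x n := by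
  cases n with
  | zero =>
    rw [koszulCycles, Submodule.mem_comap]
    induction z using TensorProduct.induction_on with
    | zero => simp only [map_zero, zero_mem]
    | add y z hy hz => simp only [map_add]; exact add_mem hy hz
    | tmul r f =>
      rw [leftKoszul_tmul, map_sum]
      refine sum_mem fun i _ => ?_
      rw [counitMap_tmul, Algebra.smul_def]
      exact Ideal.mul_mem_left _ _ (Ideal.mul_mem_left _ _
        (mem_maxIdeal_of_mem one_ne_zero (x i).2))
  | succ n => exact leftKoszul_leftKoszul x n z

theorem exists_leftKoszul_eq (n : ℕ) {z : A ⊗[k] DualCoalg 𝒜 n}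
    (hz : z ∈ tensorComp 𝒜 1 (DualCoalg 𝒜 n)) (hz' : z ∈ koszulCycles x n) :
    ∃ f, leftKoszul x n (1 ⊗ₜ f) = z := by
  obtain ⟨f, rfl⟩ := exists_sum_basis_tmul x hz
  suffices ∃ g : DualCoalg 𝒜 (n + 1), ∀ i, actRight 𝒜 (x.coord i) n g = f i by
    obtain ⟨g, hg⟩ := this
    exact ⟨g, by simp only [leftKoszul_tmul, one_mul, hg]⟩
  cases n with
  | zero => exact exists_actRight_eq_zero x f
  | succ n =>
    refine exists_actRight_eq_succ x n f fun θ => ?_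
    have h0 : leftKoszul x n (∑ i, (x i : A) ⊗ₜ[k] f i) = 0 := hz'
    have := congrArg (fun z => TensorProduct.lid k _ (θ.rTensor _ z)) h0
    simpa only [map_sum, map_zero, leftKoszul_tmul, LinearMap.rTensor_tmul,
      TensorProduct.lid_tmul] using this

/-- The left Koszul complex of a Koszul algebra is a resolution of `k`. -/
theorem koszulCycles_le_range (hA : IsStandardGraded 𝒜) (hK : IsKoszul 𝒜) (n : ℕ) :
    koszulCycles x n ≤ LinearMap.range (leftKoszul x n) := by
  obtain ⟨P, _, _, gr, d, ε, hres, hspan⟩ := hK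
  -- The inductive datum is a graded isomorphism in position `n` that matches the syzygies of `P`
  -- with the Koszul cycles; exactness of the Koszul complex at `n` is then read off from the next
  -- isomorphism.
  have step : ∀ n, (∃ θ : P n ≃ₗ[A] A ⊗[k] DualCoalg 𝒜 n,
      (∀ j y, y ∈ gr n (n + j) ↔ θ y ∈ tensorComp 𝒜 j (DualCoalg 𝒜 n)) ∧
        ∀ y, y ∈ LinearMap.range (d n) ↔ θ y ∈ koszulCycles x n) →
      koszulCycles x n ≤ LinearMap.range (leftKoszul x n) ∧
        ∃ θ : P (n + 1) ≃ₗ[A] A ⊗[k] DualCoalg 𝒜 (n + 1),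
          (∀ j y, y ∈ gr (n + 1) (n + 1 + j) ↔ θ y ∈ tensorComp 𝒜 j (DualCoalg 𝒜 (n + 1))) ∧
            ∀ y, y ∈ LinearMap.range (d (n + 1)) ↔ θ y ∈ koszulCycles x (n + 1) := by
    rintro n ⟨θ, hθ, hθd⟩
    obtain ⟨θ', h1, h2⟩ := exists_equiv_tensor hA (hres.gradedFree (n + 2)).toIsGradedModule
      (hres.gradedFree (n + 1)) (hres.gradedFree n).toIsGradedModule (hspan (n + 2))
      (hspan (n + 1)) (hres.map_mem (n + 1)) (hres.map_mem n) (hres.exact n) θ (leftKoszul x n)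
      (fun w hw => leftKoszul_injective x n hw)
      (fun w => by
        rw [hθ, hθd, LinearEquiv.apply_symm_apply]
        refine ⟨?_, leftKoszul_mem_koszulCycles x n _⟩
        rw [leftKoszul_tmul]
        refine sum_mem fun i _ => ?_
        rw [one_mul]
        exact tmul_mem_tensorComp (x i).2 _)
      (fun y hy hy' => exists_leftKoszul_eq x n ((hθ 1 y).1 hy) ((hθd y).1 hy'))
    refine ⟨fun z hz => ?_, θ', h2, fun y => ?_⟩
    · obtain ⟨u, hu⟩ := (hθd (θ.symm z)).2 (by rwa [LinearEquiv.apply_symm_apply])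
      exact ⟨θ' u, by rw [h1, hu, LinearEquiv.apply_symm_apply]⟩
    · rw [koszulCycles, LinearMap.mem_ker, h1, LinearEquiv.map_eq_zero_iff]
      exact (hres.exact n y).symm
  have all : ∀ n, ∃ θ : P n ≃ₗ[A] A ⊗[k] DualCoalg 𝒜 n,
      (∀ j y, y ∈ gr n (n + j) ↔ θ y ∈ tensorComp 𝒜 j (DualCoalg 𝒜 n)) ∧
        ∀ y, y ∈ LinearMap.range (d n) ↔ θ y ∈ koszulCycles x n := by
    intro n
    induction n with
    | zero =>
      obtain ⟨e, he⟩ := exists_counit 𝒜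
      obtain ⟨θ', h1, h2⟩ := exists_equiv_tensor hA (hres.gradedFree 1).toIsGradedModule
        (hres.gradedFree 0) hres.gradedModule (hspan 1) (hspan 0) (hres.map_mem 0)
        hres.augmentation_mem hres.exact_augmentation (LinearEquiv.refl A _)
        ((Submodule.mkQ (maxIdeal 𝒜)) ∘ₗ counitMap 𝒜)
        (fun w hw => by
          rw [LinearMap.comp_apply, Submodule.mkQ_apply, Submodule.Quotient.mk_eq_zero,
            counitMap_tmul, ← coeffZero_eq_zero_iff hA, map_smul, coeffZero_one, smul_eq_mul,
            mul_one] at hw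
          exact dualCoalg_zero_ext hw)
        (fun w => by
          refine ⟨⟨w (dualOne 𝒜) • 1, Submodule.smul_mem _ _ (SetLike.one_mem_graded 𝒜), ?_⟩,
            hres.surjective _⟩
          rw [LinearEquiv.refl_symm, LinearEquiv.refl_apply, LinearMap.comp_apply, counitMap_tmul]
          rfl)
        (by
          rintro _ ⟨r, hr, rfl⟩ -
          refine ⟨coeffZero hA r • e, ?_⟩
          rw [LinearMap.comp_apply, counitMap_tmul, LinearMap.smul_apply, he, smul_eq_mul, mul_one,
            ← Algebra.algebraMap_eq_smul_one, algebraMap_coeffZero_of_mem hA hr]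
          rfl)
      refine ⟨θ', h2, fun y => ?_⟩
      have h3 := h1 y
      rw [LinearMap.comp_apply, LinearEquiv.refl_apply, Submodule.mkQ_apply] at h3
      rw [koszulCycles, Submodule.mem_comap, ← Submodule.Quotient.mk_eq_zero (maxIdeal 𝒜), h3]
      exact (hres.exact_augmentation y).symm
    | succ n ih => exact (step n ih).2
  exact (step n (all n)).1

end LeftKoszul

end

end KoszulPowers

namespace KoszulPowers

noncomputable section

universe u v w

/-! ### Exactness of the rows and columns of the double complex -/

theorem lTensor_exact_of_exact {k : Type*} [Field k] (B : Type*) [AddCommGroup B] [Module k B]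
    {M N P : Type*} [AddCommMonoid M] [AddCommMonoid N] [AddCommMonoid P]
    [Module k M] [Module k N] [Module k P] {f : M →ₗ[k] N} {g : N →ₗ[k] P}
    (h : Function.Exact f g) : Function.Exact (f.lTensor B) (g.lTensor B) := by
  let _ : AddCommGroup M := Module.addCommMonoidToAddCommGroup k
  let _ : AddCommGroup N := Module.addCommMonoidToAddCommGroup k
  let _ : AddCommGroup P := Module.addCommMonoidToAddCommGroup k
  exact Module.Flat.lTensor_exact B h

section DoubleComplex

variable {k : Type v} {A : Type u} [Field k] [Ring A] [Algebra k A]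
  {𝒜 : ℕ → Submodule k A} [GradedAlgebra 𝒜]
  {ι : Type*} [Fintype ι] (x : Module.Basis ι k (𝒜 1))

/-- The differential `f ⊗ s ↦ ∑ x_i^* f ⊗ x_i s` of the right Koszul complex `(A^!)^* ⊗ A`. -/
def rowDiff (n a : ℕ) : DualCoalg 𝒜 (n + 1) ⊗[k] 𝒜 a →ₗ[k] DualCoalg 𝒜 n ⊗[k] 𝒜 (a + 1) :=
  ∑ i, TensorProduct.map (actLeft 𝒜 (x.coord i) n) (mulDegOne 𝒜 (x i) a)

theorem rowDiff_tmul (n a : ℕ) (f : DualCoalg 𝒜 (n + 1)) (s : 𝒜 a) :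
    rowDiff x n a (f ⊗ₜ s) =
      ∑ i, actLeft 𝒜 (x.coord i) n f ⊗ₜ[k] mulDegOne 𝒜 (x i) a s := by
  simp [rowDiff, LinearMap.sum_apply]

theorem hDiff_tmul_eq (n a : ℕ) (r : A) (w : DualCoalg 𝒜 (n + 1) ⊗[k] 𝒜 a) :
    hDiff 𝒜 x n a (r ⊗ₜ w) = r ⊗ₜ rowDiff x n a w := by
  simp [hDiff, rowDiff, LinearMap.sum_apply, TensorProduct.tmul_sum]

theorem hDiff_eq_lTensor (n a : ℕ) (z : F 𝒜 (n + 1) a) :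
    hDiff 𝒜 x n a z = (rowDiff x n a).lTensor A z := by
  induction z using TensorProduct.induction_on with
  | zero => simp only [map_zero]
  | add y z hy hz => simp only [map_add, hy, hz]
  | tmul r w => rw [hDiff_tmul_eq, LinearMap.lTensor_tmul]

theorem rowDiff_rowDiff (n a : ℕ) (z : DualCoalg 𝒜 (n + 1 + 1) ⊗[k] 𝒜 a) :
    rowDiff x n (a + 1) (rowDiff x (n + 1) a z) = 0 := by
  induction z using TensorProduct.induction_on with
  | zero => simp only [map_zero]
  | add y z hy hz => simp only [map_add, hy, hz, add_zero]
  | tmul f s =>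
    obtain ⟨e, he⟩ := exists_dual_extension (𝒜 := 𝒜) (n + 1 + 1)
    let ψ : QuadraticDual 𝒜 →ₗ[k] DualCoalg 𝒜 n :=
      ((LinearMap.mul k (QuadraticDual 𝒜)).flip.compr₂ (e f)).compl₂ (dualComp 𝒜 n).subtype
    have hψ : ∀ i j, actLeft 𝒜 (x.coord i) n (actLeft 𝒜 (x.coord j) (n + 1) f) =
        ψ (dualGen 𝒜 (x.coord i) * dualGen 𝒜 (x.coord j)) := by
      intro i j
      ext y
      rw [actLeft_apply, actLeft_apply, ← he, genMulRight_apply, genMulRight_apply, mul_assoc]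
      rfl
    have hs : ∀ i j, ((mulDegOne 𝒜 (x i) (a + 1) (mulDegOne 𝒜 (x j) a s) : 𝒜 (a + 1 + 1)) : A) =
        x i * x j * s := fun i j => (mul_assoc _ _ _).symm
    have hinj : Function.Injective
        ((𝒜 (a + 1 + 1)).subtype.lTensor (DualCoalg 𝒜 n)) :=
      Module.Flat.lTensor_preserves_injective_linearMap _ Subtype.val_injective
    apply hinj
    have := congrArg (TensorProduct.comm k A (DualCoalg 𝒜 n) ∘
      TensorProduct.map (LinearMap.mulRight k (s : A)) ψ) (sum_tmul_dualGen_mul x)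
    simp only [Function.comp_apply, map_sum, map_zero, TensorProduct.map_tmul,
      LinearMap.mulRight_apply, TensorProduct.comm_tmul, ← hψ] at this
    simp only [rowDiff_tmul, map_sum, map_zero, LinearMap.lTensor_tmul, Submodule.subtype_apply,
      hs]
    rw [Finset.sum_comm]
    exact this

theorem hDiff_hDiff (n a : ℕ) (z : F 𝒜 (n + 1 + 1) a) :
    hDiff 𝒜 x n (a + 1) (hDiff 𝒜 x (n + 1) a z) = 0 := by
  induction z using TensorProduct.induction_on with
  | zero => simp only [map_zero]
  | add y z hy hz => simp only [map_add, hy, hz, add_zero]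
  | tmul r w => rw [hDiff_tmul_eq, hDiff_tmul_eq, rowDiff_rowDiff, TensorProduct.tmul_zero]

theorem vDiff_assoc (n a : ℕ) (z : (A ⊗[k] DualCoalg 𝒜 (n + 1)) ⊗[k] 𝒜 a) :
    vDiff 𝒜 x n a (TensorProduct.assoc k _ _ _ z) =
      TensorProduct.assoc k _ _ _ (((leftKoszul x n).restrictScalars k).rTensor (𝒜 a) z) := by
  induction z using TensorProduct.induction_on with
  | zero => simp only [map_zero]
  | add y z hy hz => simp only [map_add, hy, hz]
  | tmul w s =>
    induction w using TensorProduct.induction_on with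
    | zero => simp only [map_zero, TensorProduct.zero_tmul]
    | add y z hy hz => simp only [map_add, TensorProduct.add_tmul, hy, hz]
    | tmul r f =>
      simp only [TensorProduct.assoc_tmul, vDiff_tmul, LinearMap.rTensor_tmul,
        LinearMap.restrictScalars_apply, leftKoszul_tmul, TensorProduct.sum_tmul, map_sum]

theorem vDiff_vDiff (n a : ℕ) (z : F 𝒜 (n + 1 + 1) a) :
    vDiff 𝒜 x n a (vDiff 𝒜 x (n + 1) a z) = 0 := by
  obtain ⟨z, rfl⟩ := (TensorProduct.assoc k A (DualCoalg 𝒜 (n + 1 + 1)) (𝒜 a)).surjective z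
  rw [vDiff_assoc, vDiff_assoc, ← LinearMap.comp_apply, ← LinearMap.rTensor_comp]
  have : (leftKoszul x n).restrictScalars k ∘ₗ (leftKoszul x (n + 1)).restrictScalars k = 0 :=
    LinearMap.ext fun y => leftKoszul_leftKoszul x n y
  rw [this, LinearMap.rTensor_zero, LinearMap.zero_apply, map_zero]

theorem ker_vDiff_le (hA : IsStandardGraded 𝒜) (hK : IsKoszul 𝒜) (n a : ℕ)
    {z : F 𝒜 (n + 1) a} (hz : vDiff 𝒜 x n a z = 0) :
    z ∈ LinearMap.range (vDiff 𝒜 x (n + 1) a) := by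
  obtain ⟨z, rfl⟩ := (TensorProduct.assoc k A (DualCoalg 𝒜 (n + 1)) (𝒜 a)).surjective z
  rw [vDiff_assoc, LinearEquiv.map_eq_zero_iff] at hz
  have hex : Function.Exact ((leftKoszul x (n + 1)).restrictScalars k)
      ((leftKoszul x n).restrictScalars k) := fun y =>
    ⟨fun hy => koszulCycles_le_range x hA hK (n + 1) hy, by
      rintro ⟨y, rfl⟩
      exact leftKoszul_leftKoszul x n y⟩
  obtain ⟨w, rfl⟩ := (Module.Flat.rTensor_exact (𝒜 a) hex z).1 hz
  exact ⟨_, vDiff_assoc x (n + 1) a w⟩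

theorem mulMap_assoc (hA : IsStandardGraded 𝒜) (a : ℕ)
    (z : (A ⊗[k] DualCoalg 𝒜 0) ⊗[k] 𝒜 a) :
    ((TensorProduct.lid k (𝒜 a)
      ((coeffZero hA ∘ₗ (counitMap 𝒜).restrictScalars k).rTensor (𝒜 a) z) : 𝒜 a) : A) =
      DirectSum.decompose 𝒜 (mulMap 𝒜 a (TensorProduct.assoc k _ _ _ z)) a := by
  induction z using TensorProduct.induction_on with
  | zero => simp
  | add y z hy hz =>
    simp only [map_add, Submodule.coe_add, hy, hz, DirectSum.decompose_add, DirectSum.add_apply]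
  | tmul w s =>
    induction w using TensorProduct.induction_on with
    | zero => simp
    | add y z hy hz =>
      simp only [map_add, TensorProduct.add_tmul, Submodule.coe_add, hy, hz,
        DirectSum.decompose_add, DirectSum.add_apply]
    | tmul r f =>
      have h1 := DirectSum.coe_decompose_mul_of_right_mem_of_le 𝒜 (a := r)
        ((𝒜 a).smul_mem (f (dualOne 𝒜)) s.2) le_rfl
      rw [Nat.sub_self, ← algebraMap_coeffZero hA, ← Algebra.smul_def] at h1
      rw [TensorProduct.assoc_tmul, mulMap_tmul, h1, LinearMap.rTensor_tmul,
        TensorProduct.lid_tmul, LinearMap.comp_apply, LinearMap.restrictScalars_apply,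
        counitMap_tmul, map_smul, Submodule.coe_smul, smul_smul, smul_eq_mul, mul_comm]

/-- The column is augmented to `k ⊗ A_a`, not to `𝔪^a`. That augmentation is the degree `a`
component of the product (`mulMap_assoc`), so a vanishing product places `z` in its kernel. -/
theorem ker_mulMap_le (hA : IsStandardGraded 𝒜) (hK : IsKoszul 𝒜) (a : ℕ)
    {z : F 𝒜 0 a} (hz : mulMap 𝒜 a z = 0) :
    z ∈ LinearMap.range (vDiff 𝒜 x 0 a) := by
  obtain ⟨z, rfl⟩ := (TensorProduct.assoc k A (DualCoalg 𝒜 0) (𝒜 a)).surjective z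
  have h1 := mulMap_assoc hA a z
  rw [hz, DirectSum.decompose_zero, DirectSum.zero_apply, Submodule.coe_zero,
    ZeroMemClass.coe_eq_zero, LinearEquiv.map_eq_zero_iff] at h1
  have hex : Function.Exact ((leftKoszul x 0).restrictScalars k)
      (coeffZero hA ∘ₗ (counitMap 𝒜).restrictScalars k) := fun y => by
    rw [LinearMap.comp_apply, LinearMap.restrictScalars_apply, coeffZero_eq_zero_iff]
    refine ⟨fun hy => koszulCycles_le_range x hA hK 0 hy, ?_⟩
    rintro ⟨y, rfl⟩
    exact leftKoszul_mem_koszulCycles x 0 y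
  obtain ⟨w, rfl⟩ := (Module.Flat.rTensor_exact (𝒜 a) hex z).1 h1
  exact ⟨_, vDiff_assoc x 0 a w⟩

theorem F_induction {n a : ℕ} {p : F 𝒜 n a → Prop} (h0 : p 0)
    (hadd : ∀ y z, p y → p z → p (y + z)) (htmul : ∀ r f s, p (r ⊗ₜ (f ⊗ₜ s))) (z : F 𝒜 n a) :
    p z := by
  induction z using TensorProduct.induction_on with
  | zero => exact h0
  | add y z hy hz => exact hadd y z hy hz
  | tmul r w =>
    induction w using TensorProduct.induction_on with
    | zero => rwa [TensorProduct.tmul_zero]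
    | add y z hy hz => rw [TensorProduct.tmul_add]; exact hadd _ _ hy hz
    | tmul f s => exact htmul r f s

theorem mulMap_vDiff (a : ℕ) (z : F 𝒜 1 a) :
    mulMap 𝒜 a (vDiff 𝒜 x 0 a z) = mulMap 𝒜 (a + 1) (hDiff 𝒜 x 0 a z) := by
  induction z using F_induction with
  | h0 => simp only [map_zero]
  | hadd y z hy hz => simp only [map_add, hy, hz]
  | htmul r f s =>
    rw [vDiff_tmul, hDiff_tmul, map_sum, map_sum]
    refine Finset.sum_congr rfl fun i _ => ?_
    rw [mulMap_tmul, mulMap_tmul, actRight_apply, actLeft_apply]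
    have h1 : genMulLeft 𝒜 (x.coord i) 0 (dualOne 𝒜) = genMulRight 𝒜 (x.coord i) 0 (dualOne 𝒜) :=
      Subtype.ext ((mul_one _).trans (one_mul _).symm)
    have h2 : ((mulDegOne 𝒜 (x i) a s : 𝒜 (a + 1)) : A) = x i * s := rfl
    rw [h1, h2, mul_assoc, mul_smul_comm]

/-- As `A_{a+1} = A_1 A_a`, it suffices to reach `f ⊗ v s`. There are no relations in degree one of
`A^!`, so some `g` satisfies `x_i^* g = x_i^*(v) f` for all `i`, and `g ⊗ s` maps to `f ⊗ v s`. -/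
theorem hDiff_zero_surjective (hA : IsStandardGraded 𝒜) (a : ℕ) :
    Function.Surjective (hDiff 𝒜 x 0 a) := by
  rw [← LinearMap.range_eq_top, eq_top_iff]
  rintro z -
  have key : ∀ (v : 𝒜 1) (s : 𝒜 a) (f : DualCoalg 𝒜 0), ∃ w : DualCoalg 𝒜 1 ⊗[k] 𝒜 a,
      rowDiff x 0 a w = f ⊗ₜ[k] mulDegOne 𝒜 v a s := by
    intro v s f
    obtain ⟨g, hg⟩ := exists_actRight_eq_zero x fun i => x.repr v i • f
    refine ⟨g ⊗ₜ s, ?_⟩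
    have hg' : ∀ i, actLeft 𝒜 (x.coord i) 0 g = x.repr v i • f := by
      intro i
      rw [← hg]
      apply dualCoalg_zero_ext
      rw [actLeft_apply, actRight_apply]
      exact congrArg g (Subtype.ext ((one_mul _).trans (mul_one _).symm))
    have hv : mulDegOne 𝒜 v a s = ∑ i, x.repr v i • mulDegOne 𝒜 (x i) a s := by
      apply Subtype.ext
      rw [Submodule.coe_sum]
      have : (v : A) = ∑ i, x.repr v i • (x i : A) := by
        conv_lhs => rw [← x.sum_repr v]
        rw [Submodule.coe_sum]
        rfl
      change (v : A) * s = ∑ i, x.repr v i • ((x i : A) * s)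
      rw [this, Finset.sum_mul]
      simp only [smul_mul_assoc]
    rw [rowDiff_tmul, hv, TensorProduct.tmul_sum]
    refine Finset.sum_congr rfl fun i _ => ?_
    rw [hg', TensorProduct.smul_tmul]
  induction z using F_induction with
  | h0 => exact zero_mem _
  | hadd y z hy hz => exact add_mem hy hz
  | htmul r f s =>
    suffices h : ∃ w, rowDiff x 0 a w = f ⊗ₜ[k] s by
      obtain ⟨w, hw⟩ := h
      exact ⟨r ⊗ₜ w, by rw [hDiff_tmul_eq, hw]⟩
    suffices h : ∀ s' ∈ 𝒜 1 * 𝒜 a, ∀ hs' : s' ∈ 𝒜 (a + 1), ∃ w,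
        rowDiff x 0 a w = f ⊗ₜ[k] (⟨s', hs'⟩ : 𝒜 (a + 1)) from
      h s (mem_mul_of_mem_succ hA a s.2) s.2
    have hle : 𝒜 1 * 𝒜 a ≤ 𝒜 (a + 1) := Submodule.mul_le.2 fun v hv t ht => by
      rw [add_comm]; exact SetLike.mul_mem_graded hv ht
    intro s' hs'
    induction hs' using Submodule.mul_induction_on' with
    | mem_mul_mem v hv t ht => exact fun _ => key ⟨v, hv⟩ ⟨t, ht⟩ f
    | add y hy z hz hy' hz' =>
      intro _
      obtain ⟨u, hu⟩ := hy' (hle hy)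
      obtain ⟨w, hw⟩ := hz' (hle hz)
      refine ⟨u + w, ?_⟩
      rw [map_add, hu, hw, ← TensorProduct.tmul_add]
      rfl

theorem mulMap_zero_injective (hA : IsStandardGraded 𝒜) :
    ∀ z : F 𝒜 0 0, mulMap 𝒜 0 z = 0 → z = 0 := by
  obtain ⟨e, he⟩ := exists_counit 𝒜
  let o : 𝒜 0 := ⟨1, SetLike.one_mem_graded 𝒜⟩
  have key : ∀ z : F 𝒜 0 0, z = mulMap 𝒜 0 z ⊗ₜ (e ⊗ₜ o) := by
    intro z
    induction z using F_induction with
    | h0 => rw [map_zero, TensorProduct.zero_tmul]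
    | hadd y z hy hz => rw [map_add, TensorProduct.add_tmul, ← hy, ← hz]
    | htmul r f s =>
      have hf : f = f (dualOne 𝒜) • e :=
        dualCoalg_zero_ext (by rw [LinearMap.smul_apply, he, smul_eq_mul, mul_one])
      have hs : s = coeffZero hA s • o := by
        apply Subtype.ext
        rw [Submodule.coe_smul, ← Algebra.algebraMap_eq_smul_one, algebraMap_coeffZero_of_mem hA s.2]
      have hr : mulMap 𝒜 0 (r ⊗ₜ (f ⊗ₜ s)) = coeffZero hA s • f (dualOne 𝒜) • r := by
        rw [mulMap_tmul, ← algebraMap_coeffZero_of_mem hA s.2, mul_smul_comm, ← Algebra.commutes,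
          ← Algebra.smul_def, coeffZero_algebraMap, smul_comm]
      rw [hr]
      conv_lhs => rw [hf, hs]
      simp only [TensorProduct.tmul_smul, ← TensorProduct.smul_tmul']
  intro z hz
  rw [key z, hz, TensorProduct.zero_tmul]

/-- The reduction `F_{n,a} → k ⊗_A F_{n,a} = (A^!)^*_n ⊗ A_a`. -/
def reduction (hA : IsStandardGraded 𝒜) (n a : ℕ) : F 𝒜 n a →ₗ[k] DualCoalg 𝒜 n ⊗[k] 𝒜 a :=
  (TensorProduct.lid k _).toLinearMap ∘ₗ (coeffZero hA).rTensor _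

theorem reduction_tmul (hA : IsStandardGraded 𝒜) (n a : ℕ) (r : A)
    (w : DualCoalg 𝒜 n ⊗[k] 𝒜 a) : reduction hA n a (r ⊗ₜ w) = coeffZero hA r • w := by
  simp [reduction]

theorem reduction_hDiff (hA : IsStandardGraded 𝒜) (n a : ℕ) (z : F 𝒜 (n + 1) a) :
    reduction hA n (a + 1) (hDiff 𝒜 x n a z) = rowDiff x n a (reduction hA (n + 1) a z) := by
  induction z using TensorProduct.induction_on with
  | zero => simp only [map_zero]
  | add y z hy hz => simp only [map_add, hy, hz]
  | tmul r w => rw [hDiff_tmul_eq, reduction_tmul, reduction_tmul, map_smul]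

theorem reduction_vDiff (hA : IsStandardGraded 𝒜) (n a : ℕ) (z : F 𝒜 (n + 1) a) :
    reduction hA n a (vDiff 𝒜 x n a z) = 0 := by
  induction z using F_induction with
  | h0 => simp only [map_zero]
  | hadd y z hy hz => simp only [map_add, hy, hz, add_zero]
  | htmul r f s =>
    rw [vDiff_tmul, map_sum]
    refine Finset.sum_eq_zero fun i _ => ?_
    rw [reduction_tmul, coeffZero_mul_of_mem hA r (x i).2, zero_smul]

/-- The cycles of the rows of the double complex, augmented by the multiplication maps. -/
def rowCycles : ∀ n a, Submodule A (F 𝒜 n a)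
  | 0, a => LinearMap.ker (mulMap 𝒜 a)
  | n + 1, a => LinearMap.ker (hDiff 𝒜 x n a)

/-! ### Row exactness from column exactness -/

theorem L_le_rowCycles (n a : ℕ) : L 𝒜 x (n + 1) a ≤ rowCycles x (n + 1) a := by
  cases a with
  | zero => exact bot_le
  | succ a =>
    rintro _ ⟨y, rfl⟩
    exact hDiff_hDiff x n a y

theorem vDiff_mem_rowCycles (n a : ℕ) {z : F 𝒜 (n + 1) a} (hz : z ∈ rowCycles x (n + 1) a) :
    vDiff 𝒜 x n a z ∈ rowCycles x n a := by
  have hz' : hDiff 𝒜 x n a z = 0 := hz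
  cases n with
  | zero =>
    change mulMap 𝒜 a (vDiff 𝒜 x 0 a z) = 0
    rw [mulMap_vDiff, hz', map_zero]
  | succ n =>
    change hDiff 𝒜 x n a (vDiff 𝒜 x (n + 1) a z) = 0
    rw [← vDiff_hDiff, hz', map_zero]

theorem vDiff_mem_rowCycles_of_hDiff_eq (n a : ℕ) {y : F 𝒜 (n + 1) (a + 1)} {z : F 𝒜 (n + 1) a}
    (hyz : hDiff 𝒜 x n a z = vDiff 𝒜 x n (a + 1) y)
    (hy : vDiff 𝒜 x n (a + 1) y ∈ rowCycles x n (a + 1)) :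
    vDiff 𝒜 x n a z ∈ rowCycles x n a := by
  cases n with
  | zero =>
    change mulMap 𝒜 a (vDiff 𝒜 x 0 a z) = 0
    rw [mulMap_vDiff, hyz]
    exact hy
  | succ n =>
    change hDiff 𝒜 x n a (vDiff 𝒜 x (n + 1) a z) = 0
    rw [← vDiff_hDiff, hyz, vDiff_vDiff]

/-- Zigzag: write `∂' y = ∂'' z` with `z` one step lower in `a`. Then `∂' z` is again a row cycle,
so `z = l + ∂' w` with `∂'' l = 0`, and `y - ∂'' w` is a column cycle. -/
theorem mem_sup_range_of_rowCycles_le (hA : IsStandardGraded 𝒜) (hK : IsKoszul 𝒜) (n : ℕ)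
    (hn : ∀ a, rowCycles x n a ≤ L 𝒜 x n a) (a : ℕ) (y : F 𝒜 (n + 1) a)
    (hy : vDiff 𝒜 x n a y ∈ rowCycles x n a) :
    y ∈ L 𝒜 x (n + 1) a ⊔ LinearMap.range (vDiff 𝒜 x (n + 1) a) := by
  induction a with
  -- Here `L_{n,0} = 0`, so `hn` turns `hy` into `∂' y = 0`.
  | zero => exact Submodule.mem_sup_right (ker_vDiff_le x hA hK n 0 (hn 0 hy))
  | succ a ih =>
    obtain ⟨z, hz⟩ := hn (a + 1) hy
    obtain ⟨l, hl, _, ⟨w, rfl⟩, rfl⟩ :=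
      Submodule.mem_sup.1 (ih z (vDiff_mem_rowCycles_of_hDiff_eq x n a hz hy))
    have hl0 : hDiff 𝒜 x n a l = 0 := L_le_rowCycles x n a hl
    have h0 : vDiff 𝒜 x n (a + 1) (y - hDiff 𝒜 x (n + 1) a w) = 0 := by
      rw [map_sub, ← hz, vDiff_hDiff, map_add, hl0, zero_add, sub_self]
    rw [← add_sub_cancel (hDiff 𝒜 x (n + 1) a w) y]
    exact Submodule.add_mem_sup ⟨w, rfl⟩ (ker_vDiff_le x hA hK n (a + 1) h0)

theorem rowCycles_le_L (hA : IsStandardGraded 𝒜) (hK : IsKoszul 𝒜) (n a : ℕ) :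
    rowCycles x n a ≤ L 𝒜 x n a := by
  induction n generalizing a with
  | zero =>
    intro z hz
    cases a with
    | zero => exact mulMap_zero_injective hA z hz
    | succ a => exact hDiff_zero_surjective x hA a z
  | succ n ih =>
    -- Write `1 ⊗ w = l + ∂' u` by the zigzag; reduction modulo `𝔪` kills `∂' u` and returns `w` on
    -- the left.
    have hred : ∀ w : DualCoalg 𝒜 (n + 1) ⊗[k] 𝒜 a, rowDiff x n a w = 0 →
        ∃ l ∈ L 𝒜 x (n + 1) a, reduction hA (n + 1) a l = w := by
      intro w hw
      have hmem : (1 : A) ⊗ₜ[k] w ∈ rowCycles x (n + 1) a := by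
        change hDiff 𝒜 x n a (1 ⊗ₜ w) = 0
        rw [hDiff_tmul_eq, hw, TensorProduct.tmul_zero]
      obtain ⟨l, hl, _, ⟨u, rfl⟩, hlu⟩ := Submodule.mem_sup.1
        (mem_sup_range_of_rowCycles_le x hA hK n ih a _ (vDiff_mem_rowCycles x n a hmem))
      refine ⟨l, hl, ?_⟩
      have := congrArg (reduction hA (n + 1) a) hlu
      rwa [map_add, reduction_vDiff, add_zero, reduction_tmul, coeffZero_one, one_smul] at this
    intro z hz
    replace hz : hDiff 𝒜 x n a z = 0 := hz
    rw [hDiff_eq_lTensor] at hz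
    cases a with
    | zero =>
      -- Since `L_{n+1,0} = 0`, `hred` leaves no nonzero cycle.
      have hinj : Function.Injective (rowDiff x n 0) := by
        rw [injective_iff_map_eq_zero]
        intro w hw
        obtain ⟨l, hl, rfl⟩ := hred w hw
        obtain rfl : l = 0 := hl
        exact map_zero _
      exact Module.Flat.lTensor_preserves_injective_linearMap (M := A) _ hinj
        (hz.trans (map_zero _).symm)
    | succ a =>
      have hex : Function.Exact (rowDiff x (n + 1) a) (rowDiff x n (a + 1)) := fun w => by
        refine ⟨fun hw => ?_, ?_⟩
        · obtain ⟨_, ⟨u, rfl⟩, rfl⟩ := hred w hw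
          exact ⟨_, (reduction_hDiff x hA (n + 1) a u).symm⟩
        · rintro ⟨u, rfl⟩
          exact rowDiff_rowDiff x n a u
      obtain ⟨u, hu⟩ := (lTensor_exact_of_exact A hex z).1 hz
      rw [← hu]
      exact ⟨u, hDiff_eq_lTensor x (n + 1) a u⟩

theorem exists_mem_L_vDiff_eq (hA : IsStandardGraded 𝒜) (hK : IsKoszul 𝒜) (n a : ℕ)
    (w : F 𝒜 (n + 1) a) (hw : vDiff 𝒜 x n a w ∈ rowCycles x n a) :
    ∃ l ∈ L 𝒜 x (n + 1) a, vDiff 𝒜 x n a l = vDiff 𝒜 x n a w := by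
  obtain ⟨l, hl, _, ⟨u, rfl⟩, rfl⟩ := Submodule.mem_sup.1
    (mem_sup_range_of_rowCycles_le x hA hK n (rowCycles_le_L x hA hK n) a w hw)
  exact ⟨l, hl, by rw [map_add, vDiff_vDiff, add_zero]⟩

end DoubleComplex

end

end KoszulPowers

namespace KoszulPowers

noncomputable section

universe u v w

/-! ### The gradings -/

/-- For a subobject of a graded group: the ambient projections separate the components, without
first checking that they preserve the subobject. Only spanning remains to be shown in each case. -/
theorem isInternal_of_projections {X Y : Type*} [AddCommGroup X] [AddCommGroup Y]
    {gr : ℕ → AddSubgroup X} (j : X →+ Y) (hj : Function.Injective j) (π : ℕ → X →+ Y)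
    (hπ : ∀ e, ∀ y ∈ gr e, π e y = j y) (hπ' : ∀ e e', e ≠ e' → ∀ y ∈ gr e, π e' y = 0)
    (hsup : ∀ y, y ∈ ⨆ e, gr e) : DirectSum.IsInternal gr := by
  classical
  have hcomp : ∀ (z : DirectSum ℕ fun e => gr e) e,
      π e (DirectSum.coeAddMonoidHom gr z) = j (z e) := by
    intro z e
    induction z using DirectSum.induction_on with
    | zero => simp
    | of i y =>
      rw [DirectSum.coeAddMonoidHom_of]
      by_cases hi : i = e
      · subst hi
        rw [hπ _ _ y.2, DirectSum.of_eq_same]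
      · rw [hπ' _ _ hi _ y.2, DirectSum.of_eq_of_ne _ _ _ (Ne.symm hi), AddSubgroup.coe_zero,
          map_zero]
    | add y z hy hz =>
      rw [map_add, map_add, hy, hz, DirectSum.add_apply, AddSubgroup.coe_add, map_add]
  constructor
  · rw [injective_iff_map_eq_zero]
    intro z hz
    ext e
    apply hj
    rw [← hcomp, hz, map_zero, DirectSum.zero_apply, AddSubgroup.coe_zero, map_zero]
  · intro y
    have hle : ⨆ e, gr e ≤ (DirectSum.coeAddMonoidHom gr).range :=
      iSup_le fun e y hy => ⟨DirectSum.of (fun e => gr e) e ⟨y, hy⟩,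
        DirectSum.coeAddMonoidHom_of gr e ⟨y, hy⟩⟩
    exact hle (hsup y)

theorem exists_basis_of_field (k : Type*) [Field k] (W : Type w) [AddCommMonoid W] [Module k W] :
    ∃ κ : Type w, Nonempty (Module.Basis κ k W) :=
  let _ : AddCommGroup W := Module.addCommMonoidToAddCommGroup k
  ⟨_, ⟨Module.Basis.ofVectorSpace k W⟩⟩

section Gradings

variable {k : Type v} {A : Type u} [Field k] [Ring A] [Algebra k A]
  {𝒜 : ℕ → Submodule k A} [GradedAlgebra 𝒜]

theorem isGradedModule_idealGrading {I : Ideal A} (hI : I.IsHomogeneous 𝒜) :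
    IsGradedModule 𝒜 (idealGrading 𝒜 I) where
  isInternal := by
    classical
    refine isInternal_of_projections (Submodule.subtype I).toAddMonoidHom Subtype.val_injective
      (fun e => (GradedAlgebra.proj 𝒜 e).toAddMonoidHom.comp (Submodule.subtype I).toAddMonoidHom)
      (fun e y hy => DirectSum.decompose_of_mem_same 𝒜 hy)
      (fun e e' he y hy => DirectSum.decompose_of_mem_ne 𝒜 hy he) fun y => ?_
    have : y = ∑ i ∈ (DirectSum.decompose 𝒜 (y : A)).support,
        (⟨DirectSum.decompose 𝒜 (y : A) i, hI i y.2⟩ : I) := by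
      apply Subtype.ext
      rw [Submodule.coe_sum]
      exact (DirectSum.sum_support_decompose 𝒜 (y : A)).symm
    rw [this]
    refine sum_mem fun i _ => AddSubgroup.mem_iSup_of_mem i ?_
    exact SetLike.coe_mem (DirectSum.decompose 𝒜 (y : A) i)
  smul_mem hr hy := SetLike.mul_mem_graded (A := 𝒜) hr hy

theorem smul_mem_fGrading {n a i e : ℕ} {r : A} {z : F 𝒜 n a} (hr : r ∈ 𝒜 i)
    (hz : z ∈ fGrading 𝒜 n a e) : r • z ∈ fGrading 𝒜 n a (i + e) := by
  induction hz using AddSubgroup.closure_induction with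
  | mem z hz =>
    obtain ⟨j, s, w, he, hs, rfl⟩ := hz
    exact AddSubgroup.subset_closure
      ⟨i + j, r * s, w, by omega, SetLike.mul_mem_graded hr hs, TensorProduct.smul_tmul' _ _ _⟩
  | zero => rw [smul_zero]; exact zero_mem _
  | add y z _ _ hy hz => rw [smul_add]; exact add_mem hy hz
  | neg y _ hy => rw [smul_neg]; exact neg_mem hy

/-- The projection of `F_{n,a}` onto the component of degree `e`. -/
def fProj (𝒜 : ℕ → Submodule k A) [GradedAlgebra 𝒜] (n a e : ℕ) : F 𝒜 n a →ₗ[k] F 𝒜 n a :=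
  if n + a ≤ e then (GradedAlgebra.proj 𝒜 (e - (n + a))).rTensor _ else 0

theorem fProj_of_mem {n a e : ℕ} {z : F 𝒜 n a} (hz : z ∈ fGrading 𝒜 n a e) :
    fProj 𝒜 n a e z = z := by
  induction hz using AddSubgroup.closure_induction with
  | mem z hz =>
    obtain ⟨j, s, w, he, hs, rfl⟩ := hz
    rw [fProj, if_pos (by omega), LinearMap.rTensor_tmul, show e - (n + a) = j by omega,
      GradedAlgebra.proj_apply, DirectSum.decompose_of_mem_same 𝒜 hs]
  | zero => rw [map_zero]
  | add y z _ _ hy hz => rw [map_add, hy, hz]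
  | neg y _ hy => rw [map_neg, hy]

theorem fProj_of_mem_ne {n a e e' : ℕ} (hne : e ≠ e') {z : F 𝒜 n a}
    (hz : z ∈ fGrading 𝒜 n a e) : fProj 𝒜 n a e' z = 0 := by
  induction hz using AddSubgroup.closure_induction with
  | mem z hz =>
    obtain ⟨j, s, w, he, hs, rfl⟩ := hz
    rw [fProj]
    split_ifs
    · rw [LinearMap.rTensor_tmul, GradedAlgebra.proj_apply,
        DirectSum.decompose_of_mem_ne 𝒜 hs (by omega), TensorProduct.zero_tmul]
    · rfl
  | zero => rw [map_zero]
  | add y z _ _ hy hz => rw [map_add, hy, hz, add_zero]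
  | neg y _ hy => rw [map_neg, hy, neg_zero]

theorem mulMap_mem_of_mem_fGrading {a e : ℕ} {z : F 𝒜 0 a} (hz : z ∈ fGrading 𝒜 0 a e) :
    mulMap 𝒜 a z ∈ 𝒜 e := by
  induction hz using AddSubgroup.closure_induction with
  | mem z hz =>
    obtain ⟨j, r, w, rfl, hr, rfl⟩ := hz
    induction w using TensorProduct.induction_on with
    | zero => rw [TensorProduct.tmul_zero, map_zero]; exact zero_mem _
    | add y z hy hz => rw [TensorProduct.tmul_add, map_add]; exact add_mem hy hz
    | tmul f s =>
      rw [mulMap_tmul, add_zero]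
      exact SetLike.mul_mem_graded hr ((𝒜 a).smul_mem _ s.2)
  | zero => rw [map_zero]; exact zero_mem _
  | add y z _ _ hy hz => rw [map_add]; exact add_mem hy hz
  | neg y _ hy => rw [map_neg]; exact neg_mem hy

variable {ι : Type*} [Fintype ι] (x : Module.Basis ι k (𝒜 1))

theorem vDiff_tmul_eq (n a : ℕ) (r : A) (w : DualCoalg 𝒜 (n + 1) ⊗[k] 𝒜 a) :
    vDiff 𝒜 x n a (r ⊗ₜ w) =
      ∑ i, (r * (x i : A)) ⊗ₜ[k] (actRight 𝒜 (x.coord i) n).rTensor (𝒜 a) w := by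
  simp [vDiff, LinearMap.sum_apply]

theorem vDiff_mem_fGrading {n a e : ℕ} {z : F 𝒜 (n + 1) a} (hz : z ∈ fGrading 𝒜 (n + 1) a e) :
    vDiff 𝒜 x n a z ∈ fGrading 𝒜 n a e := by
  induction hz using AddSubgroup.closure_induction with
  | mem z hz =>
    obtain ⟨j, r, w, he, hr, rfl⟩ := hz
    rw [vDiff_tmul_eq]
    exact sum_mem fun i _ => AddSubgroup.subset_closure
      ⟨j + 1, _, _, by omega, SetLike.mul_mem_graded hr (x i).2, rfl⟩
  | zero => rw [map_zero]; exact zero_mem _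
  | add y z _ _ hy hz => rw [map_add]; exact add_mem hy hz
  | neg y _ hy => rw [map_neg]; exact neg_mem hy

/-- The map `∂''`, with values in `L_{n,a+1}`. -/
def hDiffToL (n a : ℕ) : F 𝒜 (n + 1) a →ₗ[A] L 𝒜 x n (a + 1) :=
  (hDiff 𝒜 x n a).codRestrict _ fun y => ⟨y, rfl⟩

theorem hDiffToL_surjective (n a : ℕ) : Function.Surjective (hDiffToL x n a) := by
  rintro ⟨_, y, rfl⟩
  exact ⟨y, rfl⟩

set_option maxHeartbeats 2000000 in
theorem isGradedModule_lGrading (n a : ℕ) :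
    IsGradedModule 𝒜 (lGrading 𝒜 x (a + 1) n) where
  isInternal := by
    refine isInternal_of_projections (L 𝒜 x n (a + 1)).subtype.toAddMonoidHom
      Subtype.val_injective
      (fun e => (fProj 𝒜 n (a + 1) e).toAddMonoidHom.comp
        (L 𝒜 x n (a + 1)).subtype.toAddMonoidHom)
      (fun e y hy => fProj_of_mem hy) (fun e e' he y hy => fProj_of_mem_ne he hy) ?_
    intro y
    -- Spanning is checked on `∂''(r ⊗ w)` with `r` homogeneous; this is homogeneous because `∂''`
    -- leaves `r` unchanged.
    obtain ⟨y, rfl⟩ := hDiffToL_surjective x n a y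
    induction y using TensorProduct.induction_on with
    | zero => rw [map_zero]; exact zero_mem _
    | add y z hy hz => rw [map_add]; exact add_mem hy hz
    | tmul r w =>
      induction r using DirectSum.Decomposition.inductionOn 𝒜 with
      | zero => rw [TensorProduct.zero_tmul, map_zero]; exact zero_mem _
      | @homogeneous j r =>
        refine AddSubgroup.mem_iSup_of_mem (j + n + (a + 1)) ?_
        exact AddSubgroup.subset_closure
          ⟨j, r, rowDiff x n a w, rfl, r.2, hDiff_tmul_eq x n a r w⟩
      | add r s hr hs => rw [TensorProduct.add_tmul, map_add]; exact add_mem hr hs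
  smul_mem hr hy := smul_mem_fGrading hr hy

set_option maxHeartbeats 2000000 in
theorem isGradedFree_lGrading (n a : ℕ) :
    IsGradedFree 𝒜 (lGrading 𝒜 x (a + 1) n) where
  toIsGradedModule := isGradedModule_lGrading x n a
  exists_basis := by
    -- `L_{n,a+1}` is `A ⊗ W`, embedded in `F_{n,a+1}` by flatness. The resulting basis `1 ⊗ bW i`
    -- lies in the single degree `n + a + 1`.
    let W := LinearMap.range (rowDiff x n a)
    let j : A ⊗[k] W →ₗ[A] F 𝒜 n (a + 1) :=
      TensorProduct.AlgebraTensorModule.map LinearMap.id W.subtype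
    have hjl : ∀ z, j z = W.subtype.lTensor A z := fun z => rfl
    have hj : Function.Injective j :=
      Module.Flat.lTensor_preserves_injective_linearMap (M := A) W.subtype Subtype.val_injective
    have hrange : LinearMap.range j = L 𝒜 x n (a + 1) := by
      apply le_antisymm
      · rintro _ ⟨z, rfl⟩
        induction z using TensorProduct.induction_on with
        | zero => rw [map_zero]; exact zero_mem _
        | add y z hy hz => rw [map_add]; exact add_mem hy hz
        | tmul r w =>
          obtain ⟨_, w, rfl⟩ := w
          exact ⟨r ⊗ₜ w, hDiff_tmul_eq x n a r w⟩
      · rintro _ ⟨z, rfl⟩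
        induction z using TensorProduct.induction_on with
        | zero => rw [map_zero]; exact zero_mem _
        | add y z hy hz => rw [map_add]; exact add_mem hy hz
        | tmul r w => exact ⟨r ⊗ₜ ⟨_, w, rfl⟩, (hDiff_tmul_eq x n a r w).symm⟩
    obtain ⟨κ, ⟨bW⟩⟩ := exists_basis_of_field k W
    let e : A ⊗[k] W ≃ₗ[A] L 𝒜 x n (a + 1) :=
      (LinearEquiv.ofInjective j hj).trans (LinearEquiv.ofEq _ _ hrange)
    refine ⟨κ, (Algebra.TensorProduct.basis A bW).map e, fun i => ⟨0 + n + (a + 1), ?_⟩⟩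
    rw [Module.Basis.map_apply, Algebra.TensorProduct.basis_apply]
    exact AddSubgroup.subset_closure
      ⟨0, 1, (bW i : DualCoalg 𝒜 n ⊗[k] 𝒜 (a + 1)), rfl, SetLike.one_mem_graded 𝒜, rfl⟩

-- Commuting the differentials gives `∂' ∂''(r ⊗ w) = ∑ (r x_i) ∂''(1 ⊗ w_i)` with `w_i` the
-- contraction of `w` by `x_i^*`. The factor `r x_i ∈ 𝔪` thus multiplies an element of `L` itself,
-- not merely of `F`.
set_option maxHeartbeats 2000000 in
theorem range_lDiff_le (n a : ℕ) :
    LinearMap.range (lDiff 𝒜 x (a + 1) n) ≤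
      maxIdeal 𝒜 • (⊤ : Submodule A (L 𝒜 x n (a + 1))) := by
  rintro _ ⟨y, rfl⟩
  obtain ⟨y, rfl⟩ := hDiffToL_surjective x (n + 1) a y
  have h1 : lDiff 𝒜 x (a + 1) n (hDiffToL x (n + 1) a y) =
      hDiffToL x n a (vDiff 𝒜 x (n + 1) a y) :=
    Subtype.ext (vDiff_hDiff 𝒜 x n a y)
  rw [h1]
  clear h1
  induction y using TensorProduct.induction_on with
  | zero => rw [map_zero, map_zero]; exact zero_mem _
  | add y z hy hz => rw [map_add, map_add]; exact add_mem hy hz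
  | tmul r w =>
    rw [vDiff_tmul_eq, map_sum]
    refine sum_mem fun i _ => ?_
    rw [← mul_one (r * (x i : A)), ← smul_eq_mul, ← TensorProduct.smul_tmul', map_smul]
    exact Submodule.smul_mem_smul
      (Ideal.mul_mem_left _ _ (mem_maxIdeal_of_mem one_ne_zero (x i).2)) trivial

theorem mulMap_range (hA : IsStandardGraded 𝒜) (a : ℕ) {y : A} (hy : y ∈ maxIdeal 𝒜 ^ a) :
    ∃ z, mulMap 𝒜 a z = y := by
  obtain ⟨e, he⟩ := exists_counit 𝒜
  rw [maxIdeal_pow_eq_span hA] at hy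
  have hle : Ideal.span (𝒜 a : Set A) ≤ LinearMap.range (mulMap 𝒜 a) :=
    Ideal.span_le.2 fun s hs => ⟨1 ⊗ₜ (e ⊗ₜ ⟨s, hs⟩), by rw [mulMap_tmul, he, one_smul, one_mul]⟩
  exact hle hy

end Gradings

end

end KoszulPowers

/-! ### The resolution of `𝔪^a` -/

set_option maxHeartbeats 2000000 in
theorem theorem5p2 {k A ι : Type*} [Field k] [Ring A] [Algebra k A]
    (𝒜 : ℕ → Submodule k A) [GradedAlgebra 𝒜]
    (hA : IsStandardGraded 𝒜) (hK : IsKoszul 𝒜)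
    [Fintype ι] (x : Module.Basis ι k (𝒜 1)) (a : ℕ) (ha : 1 ≤ a) :
    L 𝒜 x 0 a = ⊤ ∧
      (∀ n, L 𝒜 x (n + 1) a = LinearMap.ker (hDiff 𝒜 x n a)) ∧
      IsMinimalGradedFreeResolution 𝒜 (X := fun n => L 𝒜 x n a) (lGrading 𝒜 x a) (lDiff 𝒜 x a)
        (idealGrading 𝒜 (maxIdeal 𝒜 ^ a)) (augmentation x hA a) := by
  obtain ⟨a, rfl⟩ := Nat.exists_eq_succ_of_ne_zero (Nat.one_le_iff_ne_zero.1 ha)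
  have htop : L 𝒜 x 0 (a + 1) = ⊤ :=
    LinearMap.range_eq_top.2 (hDiff_zero_surjective x hA a)
  refine ⟨htop, fun n => le_antisymm (L_le_rowCycles x n (a + 1))
    (rowCycles_le_L x hA hK (n + 1) (a + 1)), ?_⟩
  refine
    { gradedFree := fun n => isGradedFree_lGrading x n a
      gradedModule := isGradedModule_idealGrading ?_
      map_mem := fun n j y hy => vDiff_mem_fGrading x hy
      augmentation_mem := fun j y hy => mulMap_mem_of_mem_fGrading hy
      exact := fun n y => ?_
      exact_augmentation := fun y => ?_
      surjective := ?_
      minimal := fun n => range_lDiff_le x n a }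
  · rw [maxIdeal_pow_eq_span hA]
    exact Ideal.homogeneous_span 𝒜 _ fun s hs => ⟨a + 1, hs⟩
  · refine ⟨fun hy => ?_, ?_⟩
    · have hy' : vDiff 𝒜 x n (a + 1) y = 0 := congrArg Subtype.val hy
      -- Column exactness gives a preimage `w` in `F`; because `y` is a row cycle, `w` can be
      -- changed by an element of `im ∂'` so as to lie in `L`.
      obtain ⟨w, hw⟩ := ker_vDiff_le x hA hK n (a + 1) hy'
      obtain ⟨l, hl, hlw⟩ := exists_mem_L_vDiff_eq x hA hK (n + 1) (a + 1) w
        (by rw [hw]; exact L_le_rowCycles x n (a + 1) y.2)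
      exact ⟨⟨l, hl⟩, Subtype.ext (hlw.trans hw)⟩
    · rintro ⟨z, rfl⟩
      exact Subtype.ext (vDiff_vDiff x n (a + 1) z)
  · refine ⟨fun hy => ?_, ?_⟩
    · have hy' : mulMap 𝒜 (a + 1) y = 0 := congrArg Subtype.val hy
      obtain ⟨w, hw⟩ := ker_mulMap_le x hA hK (a + 1) hy'
      obtain ⟨l, hl, hlw⟩ := exists_mem_L_vDiff_eq x hA hK 0 (a + 1) w (by rw [hw]; exact hy')
      exact ⟨⟨l, hl⟩, Subtype.ext (hlw.trans hw)⟩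
    · rintro ⟨z, rfl⟩
      exact Subtype.ext (vDiff_mem_rowCycles x 0 (a + 1) (L_le_rowCycles x 0 (a + 1) z.2))
  · rintro ⟨y, hy⟩
    obtain ⟨z, rfl⟩ := mulMap_range hA (a + 1) hy
    exact ⟨⟨z, htop ▸ Submodule.mem_top⟩, rfl⟩
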